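/- Let $(A,\mathfrak m)$ be a complete Noetherian local domain of dimension $d+1\ge 2$ which contains a field, whose residue field $A/\mathfrak m$ has characteristic zero, and which is not a regular local ring. Let $k\subset A$ be a coefficient field, i.e. a subfield mapping isomorphically onto $A/\mathfrak m$. Let $J\subset A$ be an ideal defining the singular locus, i.e. for every prime $\mathfrak p$ of $A$, $J\subseteq\mathfrak p$ if and only if $A_{\mathfrak p}$ is not a regular local ring. Let $0\ne f\in J$ (so $f\in\mathfrak m$) and put $R=A_f$. Let $T=k[[f]]\subset A$ be the image of the map $k[[X]]\to A$, $\sum_i c_iX^i\mapsto\sum_i c_if^i$, and let $\ell=k((f))\subset R$ be the image of the induced map $k((X))\to A_f=R$. For a ring map $S\to B$ write $\operatorname{Der}_S(B)$ for the $B$-module of $S$-linear derivations $B\to B$. Then: 1. $\operatorname{Der}_T(A)$ is a finitely generated $A$-module, and its rank satisfies $\operatorname{rank}\operatorname{Der}_T(A)=\dim_L\bigl(L\otimes_A\operatorname{Der}_T(A)\bigr)\ge d$, where $L$ is the fraction field of $A$. 2. $\operatorname{Der}_T(A)_f=\operatorname{Der}_\ell(R)$: there is an $A$-linear map $\operatorname{Der}_T(A)\to\operatorname{Der}_\ell(R)$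 taking each derivation to an extension of it to $R$, and it exhibits $\operatorname{Der}_\ell(R)$ as the localization of $\operatorname{Der}_T(A)$ at the powers of $f$. In particular $\operatorname{Der}_\ell(R)$ is a finitely generated $R$-module. 3. For every maximal ideal $\mathfrak n$ of $R$: (a) $\operatorname{Der}_\ell(R)_{\mathfrak n}=\operatorname{Der}_\ell(R_{\mathfrak n})$: there is an $R$-linear map $\operatorname{Der}_\ell(R)\to\operatorname{Der}_\ell(R_{\mathfrak n})$ taking each derivation to an extension of it to $R_{\mathfrak n}$, and it exhibits $\operatorname{Der}_\ell(R_{\mathfrak n})$ as the localization of $\operatorname{Der}_\ell(R)$ at $\mathfrak n$; (b) $\operatorname{Der}_\ell(R_{\mathfrak n})$ is a free $R_{\mathfrak n}$-module of rank $d$. 4. $\operatorname{Der}_\ell(R)$ is a projective $R$-module of rank $d$ (its localization at every prime of $R$ has rank $d$). -/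

import Mathlib

open scoped PowerSeries LaurentSeries TensorProduct

noncomputable section

/-- The singular locus of `A`: the primes `p` for which `A_p` is not a regular local ring. -/
def singularLocus (A : Type*) [CommRing A] : Set (PrimeSpectrum A) :=
  {p | ¬ IsRegularLocalRing (Localization.AtPrime p.asIdeal)}

/-- If a local ring `A` is not regular, then an ideal which defines its singular locus is contained
in the maximal ideal. -/
theorem mem_maximalIdeal_of_zeroLocus_eq {A : Type*} [CommRing A] [IsLocalRing A]
    (hA : ¬ IsRegularLocalRing A) {J : Ideal A}
    (hJ : PrimeSpectrum.zeroLocus (J : Set A) = singularLocus A) {f : A} (hf : f ∈ J) :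
    f ∈ IsLocalRing.maximalIdeal A := by
  have hm : IsLocalRing.closedPoint A ∈ singularLocus A := by
    intro hreg
    have hreg' : IsRegularLocalRing (Localization.AtPrime (IsLocalRing.maximalIdeal A)) := hreg
    let e : A ≃ₐ[A] (Localization.AtPrime (IsLocalRing.maximalIdeal A)) :=
      IsLocalization.atUnits A (IsLocalRing.maximalIdeal A).primeCompl
        (fun x ↦ by simpa using! fun a ↦ a)
    exact hA (IsRegularLocalRing.of_ringEquiv e.toRingEquiv.symm)
  rw [← hJ] at hm
  exact hm hf

theorem mk_aeval_eq_mk_aeval {k A : Type*} [Field k] [CommRing A] [Algebra k A]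
    {I : Ideal A} {f : A} (hf : f ∈ I) (n : ℕ) (P Q : Polynomial k)
    (h : PowerSeries.trunc n (P : k⟦X⟧) = PowerSeries.trunc n (Q : k⟦X⟧)) :
    Ideal.Quotient.mk (I ^ n) (Polynomial.aeval f P) =
      Ideal.Quotient.mk (I ^ n) (Polynomial.aeval f Q) := by
  rw [Ideal.Quotient.eq, ← map_sub]
  have hd : (Polynomial.X : Polynomial k) ^ n ∣ P - Q := by
    rw [Polynomial.X_pow_dvd_iff]
    intro m hm
    have := congrArg (fun S => Polynomial.coeff S m) h
    simp only [PowerSeries.coeff_trunc, if_pos hm, Polynomial.coeff_coe] at this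
    rw [Polynomial.coeff_sub, this, sub_self]
  obtain ⟨S, hS⟩ := hd
  rw [hS, map_mul, map_pow, Polynomial.aeval_X]
  exact Ideal.mul_mem_right _ _ (Ideal.pow_mem_pow hf n)

/-- The ring map `k⟦X⟧ → A / I ^ n` sending `∑ cᵢ Xⁱ` to the class of `∑_{i < n} cᵢ fⁱ`. -/
def powerSeriesEvalMod (k : Type*) {A : Type*} [Field k] [CommRing A] [Algebra k A]
    (I : Ideal A) (f : A) (hf : f ∈ I) (n : ℕ) : k⟦X⟧ →+* A ⧸ I ^ n where
  toFun p := Ideal.Quotient.mk (I ^ n) (Polynomial.aeval f (PowerSeries.trunc n p))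
  map_zero' := by simp
  map_add' p q := by simp
  map_one' := by
    rw [← map_one (Ideal.Quotient.mk (I ^ n)), ← map_one (Polynomial.aeval (R := k) f)]
    exact mk_aeval_eq_mk_aeval hf n _ _ (by simp)
  map_mul' p q := by
    rw [← map_mul, ← map_mul]
    exact mk_aeval_eq_mk_aeval hf n _ _ (by
      rw [Polynomial.coe_mul, PowerSeries.trunc_trunc_mul_trunc, PowerSeries.trunc_trunc])

theorem powerSeriesEvalMod_compat (k : Type*) {A : Type*} [Field k] [CommRing A] [Algebra k A]
    (I : Ideal A) (f : A) (hf : f ∈ I) {m n : ℕ} (hle : m ≤ n) :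
    (Ideal.Quotient.factorPow I hle).comp (powerSeriesEvalMod k I f hf n) =
      powerSeriesEvalMod k I f hf m := by
  ext p
  have := mk_aeval_eq_mk_aeval hf m (PowerSeries.trunc n p) (PowerSeries.trunc m p)
    (by rw [PowerSeries.trunc_trunc_of_le _ hle, PowerSeries.trunc_trunc])
  exact this

/-- For an `I`-adically complete `k`-algebra `A` and `f ∈ I`, the evaluation map
`k⟦X⟧ → A`, `∑ cᵢ Xⁱ ↦ ∑ cᵢ fⁱ`: the ring map with
`φ (∑ cᵢ Xⁱ) ≡ ∑_{i < n} cᵢ fⁱ` modulo `I ^ n` for every `n`. -/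
def powerSeriesEval (k : Type*) {A : Type*} [Field k] [CommRing A] [Algebra k A]
    (I : Ideal A) [IsAdicComplete I A] (f : A) (hf : f ∈ I) : k⟦X⟧ →+* A :=
  IsAdicComplete.liftRingHom I (powerSeriesEvalMod k I f hf) (powerSeriesEvalMod_compat k I f hf)

theorem mk_powerSeriesEval (k : Type*) {A : Type*} [Field k] [CommRing A] [Algebra k A]
    (I : Ideal A) [IsAdicComplete I A] (f : A) (hf : f ∈ I) (n : ℕ) (p : k⟦X⟧) :
    Ideal.Quotient.mk (I ^ n) (powerSeriesEval k I f hf p) =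
      Ideal.Quotient.mk (I ^ n) (Polynomial.aeval f (PowerSeries.trunc n p)) :=
  IsAdicComplete.mk_liftRingHom I _ (powerSeriesEvalMod_compat k I f hf) n p

theorem powerSeriesEval_coe (k : Type*) {A : Type*} [Field k] [CommRing A] [Algebra k A]
    (I : Ideal A) [IsAdicComplete I A] (f : A) (hf : f ∈ I) (P : Polynomial k) :
    powerSeriesEval k I f hf (P : k⟦X⟧) = Polynomial.aeval f P := by
  rw [IsHausdorff.eq_iff_smodEq (I := I)]
  intro n
  rw [SModEq.sub_mem, smul_eq_mul, Ideal.mul_top, ← Ideal.Quotient.eq, mk_powerSeriesEval]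
  exact mk_aeval_eq_mk_aeval hf n _ _ (by rw [PowerSeries.trunc_trunc])

theorem powerSeriesEval_X (k : Type*) {A : Type*} [Field k] [CommRing A] [Algebra k A]
    (I : Ideal A) [IsAdicComplete I A] (f : A) (hf : f ∈ I) :
    powerSeriesEval k I f hf PowerSeries.X = f := by
  rw [← Polynomial.coe_X, powerSeriesEval_coe, Polynomial.aeval_X]

/-- The map `k((X)) → A_f` obtained from `k⟦X⟧ → A`, `X ↦ f`, by inverting `X`. Here `R = A_f`. -/
def laurentSeriesEval (k : Type*) {A : Type*} [Field k] [CommRing A] [Algebra k A]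
    (I : Ideal A) [IsAdicComplete I A] (f : A) (hf : f ∈ I)
    (R : Type*) [CommRing R] [Algebra A R] [IsLocalization.Away f R] : k⸨X⸩ →+* R :=
  IsLocalization.Away.lift (S := k⸨X⸩) (PowerSeries.X : k⟦X⟧)
    (g := (algebraMap A R).comp (powerSeriesEval k I f hf)) (by
      rw [RingHom.comp_apply, powerSeriesEval_X]
      exact IsLocalization.Away.algebraMap_isUnit f)

/-- The subring `T = k⟦f⟧` of `A`. -/
def powerSeriesSubring (k : Type*) {A : Type*} [Field k] [CommRing A] [Algebra k A]
    (I : Ideal A) [IsAdicComplete I A] (f : A) (hf : f ∈ I) : Subring A :=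
  (powerSeriesEval k I f hf).range

/-- The subfield `ℓ = k((f))` of `R = A_f`, as a subring. -/
def laurentSeriesSubring (k : Type*) {A : Type*} [Field k] [CommRing A] [Algebra k A]
    (I : Ideal A) [IsAdicComplete I A] (f : A) (hf : f ∈ I)
    (R : Type*) [CommRing R] [Algebra A R] [IsLocalization.Away f R] : Subring R :=
  (laurentSeriesEval k I f hf R).range

end

/-!
The idea is to work in coordinates adapted to a maximal ideal `n` of `R = A_f`. Its trace `p` on `A`
is maximal among the primes which do not contain `f`, so that `A / p` has dimension one and `f` can
be completed to a system of parameters `f, y₁, …, y_d` of `A` with all `y_i` in `p`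
(`IsLocalRing.exists_parameters_mem`). Then `A` is a finite extension of `B = k⟦f, y⟧`
(`mvPowerSeriesEval_finite`, `mvPowerSeriesEval_injective`).

Two facts about `k⟦f⟧`-derivations follow. As the characteristic is zero, the partial derivatives
`∂/∂y_i` of `B` extend to the fraction field of `A`, and clearing denominators yields derivations
`E_i` of `A` over `T = k⟦f⟧` with `E_i(y_j) = c δ_{ij}` and `c ≠ 0` (`exists_dual_derivations`). And
a derivation over `T` into a torsion-free, `(y)`-adically separated module is determined by its
values on `y` (`Derivation.eq_zero_of_parameters`): on `B` by approximation, and on `A` because `A`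
is algebraic over `B`. By Krull's intersection theorem the separation holds for every Noetherian
domain over `A` in which `y` generates a proper ideal, in particular for `A`, `R` and `R_n`; this is
why the `y_i` are chosen in `p`. Hence every derivation over `T` into such a domain satisfies
`c D = ∑ D(y_i) E_i` (`Derivation.mul_apply_eq_sum_of_parameters`).

The first part is now immediate: `Der_T(A)` embeds into `A ^ d`, and the `E_i` are linearly
independent. For the compatibility with localization, a derivation of the localization has to be
moved into `A` by one denominator. Its restriction to `A` takes values in a finitely generated
submodule of the fraction field, by the expansion in terms of the `E_i`, so this is possible
(`IsLocalization.exists_mul_mem_of_forall`, `Derivation.exists_isLocalizedModule`).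

For the freeness, `R_n = A_p` is regular of dimension at most `d` since `f ∉ p` and `f ∈ J`, so that
its maximal ideal is generated by `d` elements; its residue field is algebraic over `ℓ`, because
`A / p` is integral over `k⟦f⟧`. In this situation `d` linearly independent derivations, here the
images of the `E_i`, force `Der_ℓ(R_n)` to be free of rank `d`
(`Derivation.exists_basis_of_linearIndependent`). Projectivity and rank of `Der_ℓ(R)` are then read
off at the maximal ideals (`Module.projective_and_rankAtStalk_eq`).
-/

/-! ### Derivations into separated modules -/

theorem Derivation.sum_smul_apply {R B M ι : Type*} [CommRing R] [CommRing B] [Algebra R B]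
    [AddCommGroup M] [Module B M] [Module R M] {C : Type*} [CommRing C] [Module C M]
    [SMulCommClass R C M] [SMulCommClass C B M] (s : Finset ι) (c : ι → C)
    (D : ι → Derivation R B M) (b : B) : (∑ i ∈ s, c i • D i) b = ∑ i ∈ s, c i • D i b := by
  classical
  induction s using Finset.induction_on with
  | empty => simp
  | insert i s hi ih => rw [Finset.sum_insert hi, Finset.sum_insert hi, Derivation.add_apply, ih,
      Derivation.smul_apply]

/-- A derivation which vanishes on `s`, and whose values are up to units values at elements of the
ideal `(s)`, is zero if its target is `(s)`-adically separated: by the Leibniz rule, inductively all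
its values lie in `(s) ^ N • M`. -/
theorem Derivation.eq_zero_of_isHausdorff {R B M : Type*} [CommRing R] [CommRing B] [Algebra R B]
    [AddCommGroup M] [Module B M] [Module R M] (D : Derivation R B M) (s : Set B)
    [IsHausdorff (Ideal.span s) M] (hs : ∀ x ∈ s, D x = 0)
    (hB : ∀ b, ∃ u : B, IsUnit u ∧ ∃ c ∈ Ideal.span s, u • D b = D c) : D = 0 := by
  have key : ∀ (N : ℕ) (b : B), D b ∈ (Ideal.span s ^ N • ⊤ : Submodule B M) := by
    intro N
    induction N with
    | zero => simp
    | succ N ih =>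
      have hspan : ∀ c ∈ Ideal.span s, D c ∈ (Ideal.span s ^ (N + 1) • ⊤ : Submodule B M) := by
        intro c hc
        induction hc using Submodule.span_induction with
        | mem x hx => rw [hs x hx]; exact zero_mem _
        | zero => rw [map_zero]; exact zero_mem _
        | add x y _ _ hx hy => rw [map_add]; exact add_mem hx hy
        | smul a x hx hDx =>
          rw [smul_eq_mul, D.leibniz]
          refine add_mem (Submodule.smul_mem _ _ hDx) ?_
          rw [pow_succ', Submodule.mul_smul]
          exact Submodule.smul_mem_smul hx (ih a)
      intro b
      obtain ⟨u, hu, c, hc, h⟩ := hB b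
      have := hspan c hc
      rw [← h] at this
      obtain ⟨u, rfl⟩ := hu
      have h2 := Submodule.smul_mem _ (↑u⁻¹ : B) this
      rwa [smul_smul, Units.inv_mul, one_smul] at h2
  ext b
  refine IsHausdorff.haus (I := Ideal.span s) inferInstance (D b) fun N => ?_
  rw [SModEq.sub_mem, sub_zero]
  exact key N b

/-- If the residue of `a` is integral over `l` and `g` is a polynomial of minimal degree, with
invertible leading coefficient, such that `g(a) ∈ 𝔪`, then `g'(a)` is a unit and
`g'(a) • D a = D (g(a))`. -/
theorem exists_isUnit_smul_eq_of_isIntegral {l S M : Type*} [CommRing l] [IsDomain l] [CharZero l]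
    (hl : ∀ n : ℕ, n ≠ 0 → IsUnit (n : l)) [CommRing S] [IsLocalRing S] [Algebra l S]
    [AddCommGroup M] [Module S M] [Module l M] [IsScalarTower l S M] (D : Derivation l S M) (a : S)
    (ha : IsIntegral l (IsLocalRing.residue S a)) :
    ∃ u : S, IsUnit u ∧ ∃ c ∈ IsLocalRing.maximalIdeal S, u • D a = D c := by
  classical
  -- a polynomial of minimal degree with invertible leading coefficient and `g a ∈ 𝔪`
  have hex : ∃ n : ℕ, ∃ g : Polynomial l, g.natDegree = n ∧ IsUnit g.leadingCoeff ∧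
      Polynomial.aeval a g ∈ IsLocalRing.maximalIdeal S := by
    obtain ⟨g, hg, h⟩ := ha
    refine ⟨_, g, rfl, by rw [hg.leadingCoeff]; exact isUnit_one, ?_⟩
    rw [← IsLocalRing.residue_eq_zero_iff]
    rw [← h, ← Polynomial.aeval_def]
    exact (Polynomial.aeval_algHom_apply
      (Ideal.Quotient.mkₐ l (IsLocalRing.maximalIdeal S)) a g).symm
  obtain ⟨g, hgn, hgu, hga⟩ := Nat.find_spec hex
  have hmin := fun m (hm : m < Nat.find hex) => Nat.find_min hex hm
  have hdeg : g.natDegree ≠ 0 := by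
    intro h0
    rw [Polynomial.eq_C_of_natDegree_eq_zero h0, Polynomial.aeval_C] at hga
    rw [Polynomial.leadingCoeff, h0] at hgu
    exact (IsLocalRing.mem_maximalIdeal _).1 hga (hgu.map (algebraMap l S))
  refine ⟨Polynomial.aeval a (Polynomial.derivative g), ?_, _, hga, (D.map_aeval g a).symm⟩
  by_contra hnu
  refine hmin (g.natDegree - 1) (by omega) ⟨Polynomial.derivative g,
    Polynomial.natDegree_derivative g, ?_, hnu⟩
  rw [Polynomial.leadingCoeff, Polynomial.natDegree_derivative, Polynomial.coeff_derivative,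
    Nat.sub_add_cancel (Nat.pos_of_ne_zero hdeg)]
  refine hgu.mul ?_
  have := hl g.natDegree hdeg
  rwa [← Nat.cast_add_one, Nat.sub_add_cancel (Nat.pos_of_ne_zero hdeg)]

/-- If `S` is local with residue field integral over `l`, and nonzero integers are invertible in `l`,
then an `l`-derivation into a finite module is determined by its values on generators of `𝔪`. The module
need not be torsion free. -/
theorem Derivation.eq_zero_of_isLocalRing {l S M : Type*} [CommRing l] [IsDomain l] [CharZero l]
    (hl : ∀ n : ℕ, n ≠ 0 → IsUnit (n : l)) [CommRing S] [IsLocalRing S] [IsNoetherianRing S]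
    [Algebra l S] (hS : ∀ a : S, IsIntegral l (IsLocalRing.residue S a))
    [AddCommGroup M] [Module S M] [Module.Finite S M] [Module l M] [IsScalarTower l S M]
    (s : Set S) (hs : IsLocalRing.maximalIdeal S = Ideal.span s)
    (D : Derivation l S M) (hD : ∀ x ∈ s, D x = 0) : D = 0 := by
  have : IsHausdorff (Ideal.span s) M := hs ▸ inferInstance
  refine D.eq_zero_of_isHausdorff s hD fun b => ?_
  rw [← hs]
  exact exists_isUnit_smul_eq_of_isIntegral hl D b (hS b)

/-- Division of a derivation by a nonzerodivisor which divides all its values. -/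
theorem Derivation.exists_smul_eq_of_dvd {R S : Type*} [CommRing R] [CommRing S] [IsDomain S]
    [Algebra R S] (D : Derivation R S S) {c : S} (hc : c ≠ 0) (h : ∀ a, c ∣ D a) :
    ∃ D' : Derivation R S S, c • D' = D := by
  choose g hg using h
  refine ⟨Derivation.mk' ⟨⟨g, fun a b => ?_⟩, fun r a => ?_⟩ fun a b => ?_, ?_⟩
  · apply mul_left_cancel₀ hc
    rw [← hg, map_add, hg a, hg b, mul_add]
  · apply mul_left_cancel₀ hc
    simp only [RingHom.id_apply]
    rw [← hg, map_smul, hg a, mul_smul_comm]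
  · apply mul_left_cancel₀ hc
    change c * g (a * b) = c * (a • g b + b • g a)
    rw [← hg, D.leibniz, hg a, hg b]
    simp only [smul_eq_mul]
    ring
  · ext a
    exact (hg a).symm

/-- Let `S` be a Noetherian local domain with residue field integral over `l`, where nonzero integers
are invertible in `l`. If `𝔪` has as many generators `x` as there are linearly independent derivations `D`, then
`Der_l(S)` is free. Indeed `G = adj(D i (x j)) • D` satisfies `G j (x k) = δ_{jk} det`; modulo `det`
each `G j` kills the generators of `𝔪`, hence is zero, so `G j` is divisible by `det`, and the
quotients `P j` form a basis dual to `x`. -/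
theorem Derivation.exists_basis_of_linearIndependent {l S : Type*} [CommRing l] [IsDomain l]
    [CharZero l] (hl : ∀ n : ℕ, n ≠ 0 → IsUnit (n : l)) [CommRing S] [IsDomain S] [IsLocalRing S]
    [IsNoetherianRing S] [Algebra l S] (hS : ∀ a : S, IsIntegral l (IsLocalRing.residue S a))
    {ι : Type*} [Fintype ι] (x : ι → S)
    (hx : IsLocalRing.maximalIdeal S = Ideal.span (Set.range x))
    (D : ι → Derivation l S S) (hD : LinearIndependent S D) :
    Nonempty (Module.Basis ι S (Derivation l S S)) := by
  classical
  have huniq : ∀ G : Derivation l S S, (∀ i, G (x i) = 0) → G = 0 := fun G hG =>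
    Derivation.eq_zero_of_isLocalRing hl hS _ hx G (by rintro _ ⟨i, rfl⟩; exact hG i)
  let A : Matrix ι ι S := Matrix.of fun i j => D i (x j)
  have hsum : ∀ (c : ι → S) (a : S), (∑ i, c i • D i) a = ∑ i, c i * D i a := fun c a =>
    Derivation.sum_smul_apply _ c D a
  -- a relation between the rows gives a combination of the `D i` which kills `x`
  have hdet : A.det ≠ 0 := by
    intro h0
    obtain ⟨v, hv, hvA⟩ := Matrix.exists_vecMul_eq_zero_iff.2 h0
    apply hv
    have hz : ∑ i, v i • D i = 0 := huniq _ fun j => by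
      rw [hsum]
      exact congrFun hvA j
    funext i
    exact Fintype.linearIndependent_iff.1 hD v hz i
  -- the derivations given by the rows of the adjugate matrix
  let G : ι → Derivation l S S := fun j => ∑ i, A.adjugate j i • D i
  have hG : ∀ j k, G j (x k) = if j = k then A.det else 0 := by
    intro j k
    have := congrFun (congrFun A.adjugate_mul j) k
    rw [Matrix.mul_apply] at this
    rw [hsum]
    refine Eq.trans this ?_
    simp [Matrix.one_apply]
  have hdvd : ∀ j a, A.det ∣ G j a := by
    intro j a
    let M := S ⧸ Ideal.span {A.det}
    let q : S →ₗ[S] M := (Ideal.span {A.det}).mkQ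
    have hz : q.compDer (G j) = 0 := by
      refine Derivation.eq_zero_of_isLocalRing hl hS _ hx _ ?_
      rintro _ ⟨k, rfl⟩
      change q (G j (x k)) = 0
      rw [hG]
      split_ifs
      · exact (Submodule.Quotient.mk_eq_zero _).2 (Ideal.mem_span_singleton_self _)
      · exact map_zero q
    have := congrArg (fun E => E a) hz
    exact Ideal.mem_span_singleton.1 ((Submodule.Quotient.mk_eq_zero _).1 this)
  choose P hP using fun j => Derivation.exists_smul_eq_of_dvd (G j) hdet (hdvd j)
  have hPx : ∀ j k, P j (x k) = if j = k then 1 else 0 := by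
    intro j k
    apply mul_left_cancel₀ hdet
    have := hG j k
    rw [← hP j] at this
    simpa using this
  have hsumP : ∀ (c : ι → S) (a : S), (∑ i, c i • P i) a = ∑ i, c i * P i a := fun c a =>
    Derivation.sum_smul_apply _ c P a
  refine ⟨Module.Basis.mk (v := P) ?_ ?_⟩
  · rw [Fintype.linearIndependent_iff]
    intro c hc i
    have := congrArg (fun E => E (x i)) hc
    simpa [hsumP, hPx] using this
  · rintro E -
    have : E = ∑ i, E (x i) • P i := by
      rw [← sub_eq_zero]
      apply huniq
      intro k
      rw [Derivation.sub_apply, hsumP]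
      simp [hPx]
    rw [this]
    exact Submodule.sum_mem _ fun i _ => Submodule.smul_mem _ _ (Submodule.subset_span ⟨i, rfl⟩)

/-! ### Evaluation of power series in several variables -/

/-- No continuity has to be assumed: a ring map sending `X` into `I` sends `X ^ n` into
`I ^ n`. -/
theorem PowerSeries.ringHom_ext_of_isHausdorff {k A : Type*} [CommRing k] [CommRing A]
    (I : Ideal A) [IsHausdorff I A] {F G : k⟦X⟧ →+* A}
    (hC : ∀ c, F (PowerSeries.C c) = G (PowerSeries.C c))
    (hX : F PowerSeries.X = G PowerSeries.X) (hG : G PowerSeries.X ∈ I) : F = G := by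
  have hpoly : ∀ P : Polynomial k, F (P : k⟦X⟧) = G (P : k⟦X⟧) := by
    intro P
    have : F.comp (Polynomial.coeToPowerSeries.ringHom) =
        G.comp (Polynomial.coeToPowerSeries.ringHom) :=
      Polynomial.ringHom_ext (fun c => by simpa using hC c) (by simpa using hX)
    exact RingHom.congr_fun this P
  ext p
  rw [IsHausdorff.eq_iff_smodEq (I := I)]
  intro n
  obtain ⟨q, hq⟩ : (PowerSeries.X : k⟦X⟧) ^ n ∣ p - (PowerSeries.trunc n p : k⟦X⟧) := by
    rw [PowerSeries.X_pow_dvd_iff]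
    intro m hm
    rw [map_sub, Polynomial.coeff_coe, PowerSeries.coeff_trunc, if_pos hm, sub_self]
  rw [sub_eq_iff_eq_add] at hq
  rw [SModEq.sub_mem, smul_eq_mul, Ideal.mul_top, hq]
  simp only [map_add, map_mul, map_pow, hpoly, hX]
  rw [add_sub_add_right_eq_sub, ← mul_sub]
  exact Ideal.mul_mem_right _ _ (Ideal.pow_mem_pow hG n)

/-- A power series all of whose monomials involve some variable of the finite set `s` lies in the
ideal generated by these variables. -/
theorem MvPowerSeries.mem_span_X_of_coeff_eq_zero {σ k : Type*} [CommRing k] (s : Finset σ)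
    (b : MvPowerSeries σ k) (h : ∀ n : σ →₀ ℕ, (∀ i ∈ s, n i = 0) → coeff n b = 0) :
    b ∈ Ideal.span ((fun i => (X i : MvPowerSeries σ k)) '' s) := by
  classical
  induction s using Finset.induction_on generalizing b with
  | empty =>
    have : b = 0 := by ext n; simpa using h n (by simp)
    simp [this]
  | insert i s hi ih =>
    -- `b₁` collects the terms of `b` in which `X i` does not occur
    let b₁ : MvPowerSeries σ k := fun n => if n i = 0 then coeff n b else 0
    have hb₁ : ∀ n, coeff n b₁ = if n i = 0 then coeff n b else 0 := fun n => rfl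
    have h1 : (X i : MvPowerSeries σ k) ∣ b - b₁ := by
      rw [X_dvd_iff]
      intro m hm
      rw [map_sub, hb₁, if_pos hm, sub_self]
    have h2 : b₁ ∈ Ideal.span ((fun i => (X i : MvPowerSeries σ k)) '' s) := by
      refine ih b₁ fun n hn => ?_
      rw [hb₁]
      split_ifs with h0
      · exact h n (by simpa [h0] using hn)
      · rfl
    rw [← sub_add_cancel b b₁]
    refine add_mem (Ideal.mem_of_dvd _ h1 (Ideal.subset_span ⟨i, by simp, rfl⟩)) ?_
    exact Ideal.span_mono (Set.image_mono (by simp)) h2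

theorem MvPowerSeries.mem_span_range_X {σ k : Type*} [Fintype σ] [CommRing k]
    (b : MvPowerSeries σ k) (h : constantCoeff b = 0) :
    b ∈ Ideal.span (Set.range (X : σ → MvPowerSeries σ k)) := by
  have := mem_span_X_of_coeff_eq_zero Finset.univ b fun n hn => by
    have : n = 0 := Finsupp.ext fun i => hn i (Finset.mem_univ i)
    rw [this]; exact h
  simpa using this

theorem PowerSeries.coeff_toMvPowerSeries {σ k : Type*} [CommRing k] (j : σ) (p : k⟦X⟧)
    (m : Unit →₀ ℕ) : MvPowerSeries.coeff (Finsupp.embDomain (Function.Embedding.punit j) m)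
      (p.toMvPowerSeries j) = MvPowerSeries.coeff m p :=
  MvPowerSeries.coeff_embDomain_rename (Function.Embedding.punit j) p m

theorem Finsupp.eq_embDomain_punit {σ : Type*} (j : σ) (n : σ →₀ ℕ) (hn : ∀ i, i ≠ j → n i = 0) :
    n = Finsupp.embDomain (Function.Embedding.punit j) (Finsupp.single () (n j)) := by
  rw [Finsupp.embDomain_single]
  ext i
  by_cases h : i = j
  · subst h; exact Finsupp.single_eq_same.symm
  · rw [hn i h, Finsupp.single_eq_of_ne]; exact h

/-- Every power series in `X 0, …, X d` is congruent to one in `X 0` modulo `X 1, …, X d`. -/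
theorem MvPowerSeries.exists_sub_toMvPowerSeries_mem {d : ℕ} {k : Type*} [CommRing k]
    (b : MvPowerSeries (Fin (d + 1)) k) : ∃ p : k⟦X⟧, b - p.toMvPowerSeries 0 ∈
      Ideal.span (Set.range fun i : Fin d => (X i.succ : MvPowerSeries (Fin (d + 1)) k)) := by
  let p : k⟦X⟧ := fun m => coeff (Finsupp.embDomain (Function.Embedding.punit 0) m) b
  refine ⟨p, ?_⟩
  have := mem_span_X_of_coeff_eq_zero (Finset.univ.map (Fin.succEmb d)) (b - p.toMvPowerSeries 0)
    fun n hn => by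
      rw [Finsupp.eq_embDomain_punit 0 n, map_sub, PowerSeries.coeff_toMvPowerSeries]
      · exact sub_self _
      · intro i hi
        obtain ⟨j, rfl⟩ := Fin.exists_succ_eq.2 hi
        exact hn _ (by simp)
  rwa [Finset.coe_map, Finset.coe_univ, Set.image_univ, ← Set.range_comp] at this

theorem MvPowerSeries.pderiv_toMvPowerSeries {σ k : Type*} [CommRing k] {i j : σ} (h : i ≠ j)
    (p : k⟦X⟧) : pderiv k i (p.toMvPowerSeries j) = 0 := by
  classical
  ext n
  rw [coeff_pderiv, PowerSeries.toMvPowerSeries_apply, coeff_rename_eq_zero, zero_mul, map_zero]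
  rintro ⟨m, hm⟩
  have := DFunLike.congr_fun hm i
  rw [Finsupp.mapDomain_of_notMem_range] at this
  · simp at this
  · rintro ⟨_, h'⟩; exact h h'.symm

theorem pow_idealOfVars_le_comap_aeval {k A σ : Type*} [CommRing k] [CommRing A] [Algebra k A]
    {I : Ideal A} {x : σ → A} (hx : ∀ i, x i ∈ I) (n : ℕ) : MvPolynomial.idealOfVars σ k ^ n ≤
      (I ^ n).comap (MvPolynomial.aeval x : MvPolynomial σ k →ₐ[k] A).toRingHom := by
  refine (Ideal.pow_right_mono ?_ n).trans (Ideal.le_comap_pow _ n)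
  rw [MvPolynomial.idealOfVars, Ideal.span_le]
  rintro _ ⟨i, rfl⟩
  simpa using hx i

/-- The ring map from power series in the variables `σ` to `A / I ^ n` which sends a power series to
the value at `x` of its truncation in total degree `n`. -/
noncomputable def mvPowerSeriesEvalMod (k : Type*) {A σ : Type*} [CommRing k] [CommRing A]
    [Algebra k A] [Finite σ] (I : Ideal A) (x : σ → A) (hx : ∀ i, x i ∈ I) (n : ℕ) :
    MvPowerSeries σ k →+* A ⧸ I ^ n :=
  (Ideal.quotientMap (I ^ n) _ (pow_idealOfVars_le_comap_aeval (k := k) hx n)).comp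
    (MvPowerSeries.truncTotalAlgHom σ k n).toRingHom

theorem mvPowerSeriesEvalMod_compat (k : Type*) {A σ : Type*} [CommRing k] [CommRing A]
    [Algebra k A] [Finite σ] (I : Ideal A) (x : σ → A) (hx : ∀ i, x i ∈ I) {m n : ℕ}
    (hle : m ≤ n) : (Ideal.Quotient.factorPow I hle).comp (mvPowerSeriesEvalMod k I x hx n) =
      mvPowerSeriesEvalMod k I x hx m := by
  ext p
  change Ideal.Quotient.factorPow I hle (Ideal.Quotient.mk _ (MvPolynomial.aeval x
    (p.truncTotal n))) = Ideal.Quotient.mk _ (MvPolynomial.aeval x (p.truncTotal m))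
  refine (Ideal.Quotient.eq).2 ?_
  rw [← map_sub]
  exact pow_idealOfVars_le_comap_aeval hx m
    (MvPowerSeries.truncTotal_sub_truncTotal_mem_pow_idealOfVars hle le_rfl p)

/-- For an `I`-adically complete `k`-algebra `A` and a finite family `x` in `I`, the evaluation map
from power series in the variables `σ` to `A`, sending the variables to `x`. It is the limit of the
evaluations of truncations modulo the powers of `I`. -/
noncomputable def mvPowerSeriesEval (k : Type*) {A σ : Type*} [CommRing k] [CommRing A]
    [Algebra k A] [Finite σ] (I : Ideal A) [IsAdicComplete I A] (x : σ → A) (hx : ∀ i, x i ∈ I) :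
    MvPowerSeries σ k →+* A :=
  IsAdicComplete.liftRingHom I (mvPowerSeriesEvalMod k I x hx)
    (mvPowerSeriesEvalMod_compat k I x hx)

theorem mk_mvPowerSeriesEval (k : Type*) {A σ : Type*} [CommRing k] [CommRing A]
    [Algebra k A] [Finite σ] (I : Ideal A) [IsAdicComplete I A] (x : σ → A) (hx : ∀ i, x i ∈ I)
    (n : ℕ) (p : MvPowerSeries σ k) :
    Ideal.Quotient.mk (I ^ n) (mvPowerSeriesEval k I x hx p) =
      Ideal.Quotient.mk (I ^ n) (MvPolynomial.aeval x (p.truncTotal n)) :=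
  IsAdicComplete.mk_liftRingHom I _ (mvPowerSeriesEvalMod_compat k I x hx) n p

theorem mvPowerSeriesEval_coe (k : Type*) {A σ : Type*} [CommRing k] [CommRing A]
    [Algebra k A] [Finite σ] (I : Ideal A) [IsAdicComplete I A] (x : σ → A) (hx : ∀ i, x i ∈ I)
    (P : MvPolynomial σ k) : mvPowerSeriesEval k I x hx P = MvPolynomial.aeval x P := by
  rw [IsHausdorff.eq_iff_smodEq (I := I)]
  intro n
  rw [SModEq.sub_mem, smul_eq_mul, Ideal.mul_top, ← Ideal.Quotient.eq, mk_mvPowerSeriesEval,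
    Ideal.Quotient.eq, ← map_sub]
  refine pow_idealOfVars_le_comap_aeval hx n ?_
  rw [MvPolynomial.mem_pow_idealOfVars_iff']
  intro m hm
  simp [MvPowerSeries.coeff_truncTotal _ hm]

theorem mvPowerSeriesEval_X (k : Type*) {A σ : Type*} [CommRing k] [CommRing A]
    [Algebra k A] [Finite σ] (I : Ideal A) [IsAdicComplete I A] (x : σ → A) (hx : ∀ i, x i ∈ I)
    (i : σ) : mvPowerSeriesEval k I x hx (MvPowerSeries.X i) = x i := by
  rw [← MvPolynomial.coe_X, mvPowerSeriesEval_coe, MvPolynomial.aeval_X]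

theorem mvPowerSeriesEval_C (k : Type*) {A σ : Type*} [CommRing k] [CommRing A]
    [Algebra k A] [Finite σ] (I : Ideal A) [IsAdicComplete I A] (x : σ → A) (hx : ∀ i, x i ∈ I)
    (c : k) : mvPowerSeriesEval k I x hx (MvPowerSeries.C c) = algebraMap k A c := by
  rw [← MvPolynomial.coe_C, mvPowerSeriesEval_coe, MvPolynomial.aeval_C]

theorem mvPowerSeriesEval_toMvPowerSeries (k : Type*) {A σ : Type*} [Field k] [CommRing A]
    [Algebra k A] [Finite σ] (I : Ideal A) [IsAdicComplete I A] (x : σ → A) (hx : ∀ i, x i ∈ I)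
    (i : σ) (p : k⟦X⟧) : mvPowerSeriesEval k I x hx (p.toMvPowerSeries i) =
      powerSeriesEval k I (x i) (hx i) p := by
  have : (mvPowerSeriesEval k I x hx).comp (PowerSeries.toMvPowerSeries i : k⟦X⟧ →ₐ[k] _).toRingHom
      = powerSeriesEval k I (x i) (hx i) := by
    refine PowerSeries.ringHom_ext_of_isHausdorff I (fun c => ?_) ?_ ?_
    · have := powerSeriesEval_coe k I (x i) (hx i) (Polynomial.C c)
      rw [Polynomial.coe_C, Polynomial.aeval_C] at this
      rw [this]
      simp [mvPowerSeriesEval_C]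
    · simp [mvPowerSeriesEval_X, powerSeriesEval_X]
    · rw [powerSeriesEval_X]; exact hx i
  exact RingHom.congr_fun this p

/-! ### Cohen structure: finiteness over a power series ring -/

theorem mem_pow_smul_top_pi {R ι : Type*} [CommRing R] [Finite ι] (I : Ideal R) (x : ι → R) :
    x ∈ (I • ⊤ : Submodule R (ι → R)) ↔ ∀ i, x i ∈ I := by
  classical
  cases nonempty_fintype ι
  constructor
  · intro h i
    induction h using Submodule.smul_induction_on' with
    | smul r hr n _ => exact I.mul_mem_right (n i) hr
    | add y _ z _ hy hz => exact I.add_mem hy hz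
  · intro h
    rw [pi_eq_sum_univ x]
    exact Submodule.sum_mem _ fun i _ => Submodule.smul_mem_smul (h i) trivial

theorem isPrecomplete_pi {R ι : Type*} [CommRing R] [Finite ι] (I : Ideal R) [IsPrecomplete I R] :
    IsPrecomplete I (ι → R) := by
  refine ⟨fun f hf => ?_⟩
  have h : ∀ i, ∃ L : R, ∀ n, f n i ≡ L [SMOD (I ^ n • ⊤ : Submodule R R)] := fun i =>
    IsPrecomplete.prec' (fun n => f n i) fun {m n} hmn => by
      have := hf hmn
      rw [SModEq.sub_mem, mem_pow_smul_top_pi] at this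
      rw [SModEq.sub_mem, smul_eq_mul, Ideal.mul_top]
      exact this i
  choose L hL using h
  refine ⟨L, fun n => ?_⟩
  rw [SModEq.sub_mem, mem_pow_smul_top_pi]
  intro i
  have := hL i n
  rwa [SModEq.sub_mem, smul_eq_mul, Ideal.mul_top] at this

/-- In a Noetherian local ring whose residue field is the image of a field `k`, the quotients by
powers of the maximal ideal are finite-dimensional over `k`; here `W` is the span of lifts of
generators. -/
theorem exists_fg_sup_maximalIdeal_pow_eq_top {k A : Type*} [Field k] [CommRing A] [IsLocalRing A]
    [IsNoetherianRing A] [Algebra k A]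
    (hk : Function.Surjective ((IsLocalRing.residue A).comp (algebraMap k A))) (n : ℕ) :
    ∃ W : Submodule k A, W.FG ∧
      W ⊔ (IsLocalRing.maximalIdeal A ^ n).restrictScalars k = ⊤ := by
  induction n with
  | zero => exact ⟨⊥, Submodule.fg_bot, by simp⟩
  | succ n ih =>
    obtain ⟨W, hW, h⟩ := ih
    obtain ⟨t, ht⟩ := IsNoetherian.noetherian (IsLocalRing.maximalIdeal A ^ n)
    refine ⟨W ⊔ Submodule.span k t, hW.sup (Submodule.fg_span t.finite_toSet), ?_⟩
    rw [← top_le_iff, ← h, sup_assoc]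
    refine sup_le_sup_left ?_ W
    intro a ha
    change a ∈ IsLocalRing.maximalIdeal A ^ n at ha
    have key : ∀ b ∈ Submodule.span A (t : Set A), b ∈ Submodule.span k (t : Set A) ⊔
        (IsLocalRing.maximalIdeal A ^ (n + 1)).restrictScalars k := by
      intro b hb
      induction hb using Submodule.span_induction with
      | mem x hx => exact Submodule.mem_sup_left (Submodule.subset_span hx)
      | zero => exact zero_mem _
      | add x y _ _ hx hy => exact add_mem hx hy
      | smul c x hx hx' =>
        obtain ⟨κ, hκ⟩ := hk (IsLocalRing.residue A c)
        have hm : c - algebraMap k A κ ∈ IsLocalRing.maximalIdeal A := by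
          rw [← IsLocalRing.residue_eq_zero_iff, map_sub, ← hκ]; simp
        rw [← sub_add_cancel c (algebraMap k A κ), add_smul, algebraMap_smul]
        refine add_mem (Submodule.mem_sup_right ?_) (Submodule.smul_mem _ _ hx')
        change _ ∈ IsLocalRing.maximalIdeal A ^ (n + 1)
        rw [pow_succ']
        refine Ideal.mul_mem_mul hm ?_
        rw [← ht]; exact hx
    exact key a (by rw [ht]; exact ha)

/-- Nakayama's lemma in its version for complete rings: generation modulo `I` suffices, with no
finiteness assumed beforehand. -/
theorem finite_of_isAdicComplete {B A : Type*} [CommRing B] [CommRing A] [Algebra B A]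
    (I : Ideal B) [IsAdicComplete I B] [IsHausdorff (I.map (algebraMap B A)) A]
    (W : Submodule B A) (hW : W.FG)
    (h : W ⊔ (I.map (algebraMap B A)).restrictScalars B = ⊤) : Module.Finite B A := by
  classical
  obtain ⟨s, hs⟩ := hW
  let g : (s → B) →ₗ[B] A := Fintype.linearCombination B (fun i : s => (i : A))
  have hg : LinearMap.range g = W := by
    rw [Fintype.range_linearCombination, ← hs]; simp
  have := isPrecomplete_pi (ι := s) I
  have : IsHausdorff I A := IsHausdorff.map_algebraMap_iff.1 ‹_›
  refine Module.Finite.of_surjective g (surjective_of_mkQ_comp_surjective (I := I) ?_)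
  rw [← LinearMap.range_eq_top, LinearMap.range_comp, hg, Submodule.map_mkQ_eq_top,
    Ideal.smul_top_eq_map, sup_comm]
  exact h

/-- If `x` generates an ideal with radical `𝔪`, then the complete local ring `A` is finite over the
power series ring in the variables `x`. -/
theorem mvPowerSeriesEval_finite {k A σ : Type*} [Field k] [CommRing A] [IsLocalRing A]
    [IsNoetherianRing A] [Algebra k A] [IsAdicComplete (IsLocalRing.maximalIdeal A) A]
    (hk : Function.Surjective ((IsLocalRing.residue A).comp (algebraMap k A)))
    [Finite σ] (x : σ → A) (hx : ∀ i, x i ∈ IsLocalRing.maximalIdeal A)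
    (hrad : IsLocalRing.maximalIdeal A ≤ (Ideal.span (Set.range x)).radical) :
    (mvPowerSeriesEval k (IsLocalRing.maximalIdeal A) x hx).Finite := by
  set φ := mvPowerSeriesEval k (IsLocalRing.maximalIdeal A) x hx with hφ
  let _ := φ.toAlgebra
  have hmap : (Ideal.span (Set.range (MvPowerSeries.X : σ → MvPowerSeries σ k))).map
      (algebraMap (MvPowerSeries σ k) A) = Ideal.span (Set.range x) := by
    rw [Ideal.map_span, ← Set.range_comp]
    congr 2
    ext i
    exact mvPowerSeriesEval_X k _ x hx i
  have hne : Ideal.span (Set.range x) ≠ ⊤ := by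
    intro h
    have : Ideal.span (Set.range x) ≤ IsLocalRing.maximalIdeal A := by
      rw [Ideal.span_le]; rintro _ ⟨i, rfl⟩; exact hx i
    exact (IsLocalRing.maximalIdeal.isMaximal A).ne_top (top_le_iff.1 (h ▸ this))
  have : IsHausdorff ((Ideal.span (Set.range (MvPowerSeries.X : σ → MvPowerSeries σ k))).map
      (algebraMap (MvPowerSeries σ k) A)) A := by
    rw [hmap]
    exact IsHausdorff.of_isLocalRing _ _ hne
  obtain ⟨N, hN⟩ := Ideal.exists_pow_le_of_le_radical_of_fg hrad (IsNoetherian.noetherian _)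
  obtain ⟨W, ⟨t, ht⟩, hW⟩ := exists_fg_sup_maximalIdeal_pow_eq_top hk N
  refine finite_of_isAdicComplete (Ideal.span (Set.range (MvPowerSeries.X : σ → _)))
    (Submodule.span (MvPowerSeries σ k) (t : Set A)) (Submodule.fg_span t.finite_toSet) ?_
  rw [hmap, eq_top_iff]
  intro a _
  obtain ⟨w, hw, m, hm, rfl⟩ := Submodule.mem_sup.1 (hW.symm ▸ Submodule.mem_top : a ∈ _)
  refine add_mem (Submodule.mem_sup_left ?_) (Submodule.mem_sup_right (hN hm))
  clear * - hw ht
  rw [← ht] at hw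
  induction hw using Submodule.span_induction with
  | mem y hy => exact Submodule.subset_span hy
  | zero => exact zero_mem _
  | add y z _ _ hy hz => exact add_mem hy hz
  | smul c y _ hy =>
    rw [Algebra.smul_def, ← mvPowerSeriesEval_C k (IsLocalRing.maximalIdeal A) x hx]
    exact Submodule.smul_mem _ (MvPowerSeries.C c) hy

/-! ### Systems of parameters -/

theorem MvPowerSeries.ringKrullDim_le_card {k σ : Type*} [Field k] [Fintype σ] :
    ringKrullDim (MvPowerSeries σ k) ≤ Fintype.card σ := by
  have : IsNoetherianRing (MvPowerSeries σ k) := MvPowerSeries.isNoetherianRing k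
  refine (ringKrullDim_le_spanFinrank_maximalIdeal _).trans ?_
  have hm : IsLocalRing.maximalIdeal (MvPowerSeries σ k) = Ideal.span (Set.range X) := by
    refine le_antisymm (fun b hb => mem_span_range_X b ?_) ?_
    · by_contra h
      exact (IsLocalRing.mem_maximalIdeal _).1 hb
        (isUnit_iff_constantCoeff.2 (isUnit_iff_ne_zero.2 h))
    · rw [Ideal.span_le]
      rintro _ ⟨i, rfl⟩
      refine (IsLocalRing.mem_maximalIdeal _).2 fun h => ?_
      have := isUnit_iff_constantCoeff.1 h
      simp at this
  rw [hm]
  have h1 := Submodule.spanFinrank_span_le_ncard_of_finite (R := MvPowerSeries σ k)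
    (Set.finite_range (X : σ → MvPowerSeries σ k))
  have h2 : (Set.range (X : σ → MvPowerSeries σ k)).ncard ≤ Fintype.card σ := by
    rw [← Set.image_univ, ← Nat.card_eq_fintype_card, ← Set.ncard_univ]
    exact Set.ncard_image_le
  exact_mod_cast h1.trans h2

/-- For a system of parameters `x`, the evaluation map is injective: otherwise it factors through
the quotient `C` by a nonzero power series, of dimension at most `d`, while parameters of a prime of
`C` below `𝔪` also cut out `𝔪`, whose height is `d + 1`. -/
theorem mvPowerSeriesEval_injective {k A : Type*} [Field k] [CommRing A] [IsLocalRing A]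
    [IsNoetherianRing A] [Algebra k A] [IsAdicComplete (IsLocalRing.maximalIdeal A) A] {d : ℕ}
    (hdim : ringKrullDim A = ((d + 1 : ℕ) : WithBot ℕ∞))
    (x : Fin (d + 1) → A) (hx : ∀ i, x i ∈ IsLocalRing.maximalIdeal A)
    (hrad : IsLocalRing.maximalIdeal A ≤ (Ideal.span (Set.range x)).radical) :
    Function.Injective (mvPowerSeriesEval k (IsLocalRing.maximalIdeal A) x hx) := by
  classical
  have : IsNoetherianRing (MvPowerSeries (Fin (d + 1)) k) := MvPowerSeries.isNoetherianRing k
  have : IsDomain (MvPowerSeries (Fin (d + 1)) k) := NoZeroDivisors.to_isDomain _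
  set φ := mvPowerSeriesEval k (IsLocalRing.maximalIdeal A) x hx with hφ
  rw [injective_iff_map_eq_zero]
  intro g hg
  by_contra hg0
  let C := MvPowerSeries (Fin (d + 1)) k ⧸ Ideal.span {g}
  have hC : ringKrullDim C + 1 ≤ ((d + 1 : ℕ) : WithBot ℕ∞) :=
    (ringKrullDim_quotient_succ_le_of_nonZeroDivisor (mem_nonZeroDivisors_of_ne_zero hg0)).trans
      (by simpa using MvPowerSeries.ringKrullDim_le_card (k := k) (σ := Fin (d + 1)))
  let ψ : C →+* A := Ideal.Quotient.lift _ φ (by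
    intro a ha
    obtain ⟨b, rfl⟩ := Ideal.mem_span_singleton.1 ha
    rw [map_mul, hg, zero_mul])
  let p := (IsLocalRing.maximalIdeal A).comap ψ
  obtain ⟨s, hs, hcard⟩ := p.exists_finset_card_eq_height_of_isNoetherianRing
  have hmin : IsLocalRing.maximalIdeal A ∈
      (Ideal.span ((s.image ψ : Finset A) : Set A)).minimalPrimes := by
    rw [Finset.coe_image]
    refine ⟨⟨inferInstance, ?_⟩, ?_⟩
    · rw [Ideal.span_le]
      rintro _ ⟨c, hc, rfl⟩
      exact hs.1.2 (Ideal.subset_span hc)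
    · rintro q ⟨hq, hsq⟩ hqm
      have h1 : p ≤ q.comap ψ := by
        refine hs.2 ⟨Ideal.comap_isPrime _ _, ?_⟩ (Ideal.comap_mono hqm)
        rw [Ideal.span_le]
        intro c hc
        exact hsq (Ideal.subset_span ⟨c, hc, rfl⟩)
      refine hrad.trans ((Ideal.IsPrime.radical_le_iff hq).2 ?_)
      rw [Ideal.span_le]
      rintro _ ⟨i, rfl⟩
      have hψ : ψ (Ideal.Quotient.mk _ (MvPowerSeries.X i)) = x i := by
        change φ _ = _
        exact mvPowerSeriesEval_X k _ x hx i
      have h2 : Ideal.Quotient.mk _ (MvPowerSeries.X i) ∈ p := by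
        rw [Ideal.mem_comap, hψ]; exact hx i
      have h3 := h1 h2
      rwa [Ideal.mem_comap, hψ] at h3
  have h1 : (IsLocalRing.maximalIdeal A).height ≤ p.height := by
    rw [← hcard]
    refine (Ideal.height_le_card_of_mem_minimalPrimes_span_finset hmin).trans ?_
    exact_mod_cast Finset.card_image_le
  have h2 : ((IsLocalRing.maximalIdeal A).height : WithBot ℕ∞) ≤ ringKrullDim C :=
    (WithBot.coe_le_coe.2 h1).trans (Ideal.height_le_ringKrullDim_of_isPrime (I := p))
  rw [IsLocalRing.maximalIdeal_height_eq_ringKrullDim, hdim] at h2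
  have h3 : ((d + 1 : ℕ) : WithBot ℕ∞) + 1 ≤ ((d + 1 : ℕ) : WithBot ℕ∞) :=
    (add_le_add_left h2 1).trans hC
  have h4 : d + 1 + 1 ≤ d + 1 := by exact_mod_cast h3
  omega

/-- A Noetherian local domain with a nonzero element lying in all nonzero primes has dimension at
most one. -/
theorem IsLocalRing.eq_maximalIdeal_of_forall_mem {D : Type*} [CommRing D] [IsDomain D]
    [IsLocalRing D] [IsNoetherianRing D] (f : D)
    (hf : ∀ q : Ideal D, q.IsPrime → q ≠ ⊥ → f ∈ q) (Q : Ideal D) [Q.IsPrime] (hQ : Q ≠ ⊥)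
    (hf0 : f ≠ 0) : Q = maximalIdeal D := by
  have hfin := Ideal.finite_minimalPrimes_of_isNoetherianRing D (Ideal.span {f})
  have hfm : f ∈ maximalIdeal D := le_maximalIdeal (Ideal.IsPrime.ne_top ‹_›) (hf Q ‹_› hQ)
  have hfle : Ideal.span {f} ≤ maximalIdeal D := by
    rwa [Ideal.span_le, Set.singleton_subset_iff]
  obtain ⟨P₀, hP₀, -⟩ := Ideal.exists_minimalPrimes_le hfle
  have hbot : ∀ P ∈ (Ideal.span {f}).minimalPrimes, ⊥ < P := by
    intro P hP
    rw [bot_lt_iff_ne_bot]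
    rintro rfl
    exact hf0 (by simpa using hP.1.2 (Ideal.mem_span_singleton_self f))
  -- a minimal prime over `(g)` has height at most one, hence is minimal over `(f)`
  have hsub : ((maximalIdeal D : Ideal D) : Set D) ⊆
      ⋃ P ∈ (hfin.toFinset : Set (Ideal D)), (P : Set D) := by
    intro g hg
    by_contra hgU
    simp only [Set.Finite.coe_toFinset, Set.mem_iUnion, SetLike.mem_coe, not_exists] at hgU
    obtain ⟨P, hP, -⟩ := Ideal.exists_minimalPrimes_le
      (show Ideal.span {g} ≤ maximalIdeal D by rwa [Ideal.span_le, Set.singleton_subset_iff])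
    have := hP.1.1
    have hht : P.height ≤ (1 : ℕ) := by
      exact_mod_cast Ideal.height_le_one_of_isPrincipal_of_mem_minimalPrimes (Ideal.span {g}) P hP
    have hPbot : P ≠ ⊥ := by
      rintro rfl
      have hg0 : g = 0 := by simpa using hP.1.2 (Ideal.mem_span_singleton_self g)
      exact hgU P₀ hP₀ (hg0 ▸ zero_mem _)
    obtain ⟨P', hP', hle⟩ := Ideal.exists_minimalPrimes_le (J := P) (I := Ideal.span {f})
      (by rw [Ideal.span_le, Set.singleton_subset_iff]; exact hf P this hPbot)
    have := hP'.1.1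
    rcases hle.eq_or_lt with rfl | hlt
    · exact hgU _ hP' (hP.1.2 (Ideal.mem_span_singleton_self g))
    · have h1 := Ideal.height_le_iff.1 hht P' this hlt
      have h0 : P'.height ≤ (0 : ℕ) := by
        rw [Nat.cast_one, Order.lt_one_iff] at h1
        simp [h1]
      have := Ideal.height_le_iff.1 h0 ⊥ Ideal.isPrime_bot (hbot P' hP')
      simp at this
  -- by prime avoidance `𝔪` itself is one of the minimal primes over `(f)`
  obtain ⟨P, hP, hle⟩ := (Ideal.subset_union_prime P₀ P₀ (fun P hP _ _ => by
    have := (hfin.mem_toFinset.1 hP).1.1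
    exact this)).1 hsub
  have hP := hfin.mem_toFinset.1 hP
  refine le_antisymm (le_maximalIdeal (Ideal.IsPrime.ne_top ‹_›)) ?_
  refine hle.trans (hP.2 ⟨‹_›, ?_⟩ ((le_maximalIdeal (Ideal.IsPrime.ne_top ‹_›)).trans hle))
  rw [Ideal.span_le, Set.singleton_subset_iff]
  exact hf Q ‹_› hQ

/-- If `f ∉ p` lies in all primes strictly above `p`, then `A / p` has dimension at most one: the
only prime which may lie strictly above `p` is `𝔪`. -/
theorem IsLocalRing.eq_maximalIdeal_of_lt {A : Type*} [CommRing A] [IsLocalRing A]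
    [IsNoetherianRing A] (f : A) (p : Ideal A) [p.IsPrime] (hfp : f ∉ p)
    (hp : ∀ q : Ideal A, q.IsPrime → p < q → f ∈ q) (Q : Ideal A) [hQ : Q.IsPrime] (hpQ : p < Q) :
    Q = maximalIdeal A := by
  have hsurj : Function.Surjective (Ideal.Quotient.mk p) := Ideal.Quotient.mk_surjective
  have := IsLocalRing.of_surjective' _ hsurj
  have hker : RingHom.ker (Ideal.Quotient.mk p) ≤ Q := by rw [Ideal.mk_ker]; exact hpQ.le
  have hQ' := Ideal.map_isPrime_of_surjective hsurj hker
  have hcomap : (Q.map (Ideal.Quotient.mk p)).comap (Ideal.Quotient.mk p) = Q := by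
    rw [Ideal.comap_map_of_surjective' _ hsurj]; exact sup_eq_left.2 hker
  have h := IsLocalRing.eq_maximalIdeal_of_forall_mem (Ideal.Quotient.mk p f) (fun q hq hq0 => by
      refine hp (q.comap (Ideal.Quotient.mk p)) (Ideal.comap_isPrime _ _) ?_
      refine lt_of_le_of_ne ?_ fun h => hq0 ?_
      · conv_lhs => rw [← Ideal.mk_ker (I := p)]
        exact Ideal.comap_mono bot_le
      · rw [← Ideal.map_comap_of_surjective _ hsurj q, ← h, Ideal.map_quotient_self])
    (Q.map (Ideal.Quotient.mk p)) (fun h => by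
      rw [h, ← RingHom.ker_eq_comap_bot, Ideal.mk_ker] at hcomap
      exact hpQ.ne hcomap) (by rwa [Ne, Ideal.Quotient.eq_zero_iff_mem])
  rw [← hcomap, h]
  exact IsLocalRing.eq_maximalIdeal (Ideal.comap_isMaximal_of_surjective _ hsurj)

theorem Ideal.exists_fin_span_eq {R : Type*} [CommRing R] (s : Finset R) {d : ℕ}
    (h : s.card ≤ d) : ∃ g : Fin d → R, Ideal.span (Set.range g) = Ideal.span (s : Set R) := by
  let e := s.equivFin
  refine ⟨fun i => if hi : (i : ℕ) < s.card then e.symm ⟨i, hi⟩ else 0, le_antisymm ?_ ?_⟩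
  · rw [Ideal.span_le]
    rintro _ ⟨i, rfl⟩
    dsimp only
    split_ifs with hi
    · exact Ideal.subset_span (e.symm ⟨i, hi⟩).2
    · exact zero_mem _
  · rw [Ideal.span_le]
    intro a ha
    refine Ideal.subset_span ⟨⟨e ⟨a, ha⟩, (e ⟨a, ha⟩).2.trans_le h⟩, ?_⟩
    simp

/-- A nonzero element of `𝔪` is part of a system of parameters. -/
theorem IsLocalRing.exists_parameters {A : Type*} [CommRing A] [IsDomain A] [IsLocalRing A]
    [IsNoetherianRing A] {d : ℕ} (hdim : ringKrullDim A = ((d + 1 : ℕ) : WithBot ℕ∞)) {f : A}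
    (hf0 : f ≠ 0) (hfm : f ∈ maximalIdeal A) :
    ∃ z : Fin d → A, maximalIdeal A = (Ideal.span {f} ⊔ Ideal.span (Set.range z)).radical := by
  classical
  let π := Ideal.Quotient.mk (Ideal.span {f})
  have hsurj : Function.Surjective π := Ideal.Quotient.mk_surjective
  have hfle : Ideal.span {f} ≤ maximalIdeal A := by
    rwa [Ideal.span_le, Set.singleton_subset_iff]
  have hC : ringKrullDim (A ⧸ Ideal.span {f}) + 1 ≤ ((d + 1 : ℕ) : WithBot ℕ∞) := by
    rw [← hdim]
    exact ringKrullDim_quotient_succ_le_of_nonZeroDivisor (mem_nonZeroDivisors_of_ne_zero hf0)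
  have hprime : ∀ q : Ideal A, q.IsPrime → Ideal.span {f} ≤ q → (q.map π).IsPrime ∧
      (q.map π).comap π = q := fun q hq hle => by
    have hker : RingHom.ker π ≤ q := by rw [Ideal.mk_ker]; exact hle
    exact ⟨Ideal.map_isPrime_of_surjective hsurj hker, by
      rw [Ideal.comap_map_of_surjective' _ hsurj]; exact sup_eq_left.2 hker⟩
  have hP := (hprime _ inferInstance hfle).1
  obtain ⟨s, hs, hcard⟩ := ((maximalIdeal A).map π).exists_finset_card_eq_height_of_isNoetherianRing
  have hsd : s.card ≤ d := by
    have h1 : ((s.card : ℕ) : WithBot ℕ∞) ≤ ringKrullDim (A ⧸ Ideal.span {f}) := by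
      have := Ideal.height_le_ringKrullDim_of_isPrime (I := (maximalIdeal A).map π)
      rw [← hcard] at this
      exact_mod_cast this
    have h2 : ((s.card : ℕ) : WithBot ℕ∞) + 1 ≤ ((d + 1 : ℕ) : WithBot ℕ∞) :=
      (add_le_add_left h1 1).trans hC
    have : s.card + 1 ≤ d + 1 := by exact_mod_cast h2
    omega
  obtain ⟨g, hg⟩ := Ideal.exists_fin_span_eq s hsd
  choose z hz using fun i => hsurj (g i)
  refine ⟨z, le_antisymm ?_ ?_⟩
  · rw [Ideal.radical_eq_sInf]
    refine le_sInf ?_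
    rintro q ⟨hle, hq⟩
    obtain ⟨hq', hq''⟩ := hprime q hq (le_sup_left.trans hle)
    rw [← hq'', ← Ideal.map_le_iff_le_comap]
    refine hs.2 ⟨hq', ?_⟩ (Ideal.map_mono (le_maximalIdeal hq.ne_top))
    rw [← hg, Ideal.span_le]
    rintro _ ⟨i, rfl⟩
    rw [← hz]
    exact Ideal.mem_map_of_mem _ (hle (Ideal.mem_sup_right (Ideal.subset_span ⟨i, rfl⟩)))
  · rw [Ideal.IsPrime.radical_le_iff inferInstance]
    refine sup_le hfle ?_
    rw [Ideal.span_le]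
    rintro _ ⟨i, rfl⟩
    have h1 : g i ∈ (maximalIdeal A).map π := hs.1.2 (hg ▸ Ideal.subset_span ⟨i, rfl⟩)
    rw [← hz] at h1
    have h2 : z i ∈ ((maximalIdeal A).map π).comap π := h1
    rwa [(hprime _ inferInstance hfle).2] at h2

/-- If `p` is maximal among the primes which do not contain `f`, then `f` is part of a system of
parameters whose remaining members lie in `p`. Indeed `𝔪` is the radical of `p + (f)`, so in a system
of parameters `f, z` one may replace `z i` by a power, and then subtract a multiple of `f`. -/
theorem IsLocalRing.exists_parameters_mem {A : Type*} [CommRing A] [IsDomain A] [IsLocalRing A]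
    [IsNoetherianRing A] {d : ℕ} (hdim : ringKrullDim A = ((d + 1 : ℕ) : WithBot ℕ∞)) {f : A}
    (hfm : f ∈ maximalIdeal A) (p : Ideal A) [hp' : p.IsPrime] (hfp : f ∉ p)
    (hp : ∀ q : Ideal A, q.IsPrime → p < q → f ∈ q) :
    ∃ y : Fin d → A, (∀ i, y i ∈ p) ∧
      maximalIdeal A ≤ (Ideal.span (Set.range (Fin.cons f y : Fin (d + 1) → A))).radical := by
  obtain ⟨z, hz⟩ := exists_parameters hdim (f := f) (fun h => hfp (h ▸ zero_mem p)) hfm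
  have hrad : maximalIdeal A ≤ (p ⊔ Ideal.span {f}).radical := by
    rw [Ideal.radical_eq_sInf]
    refine le_sInf ?_
    rintro q ⟨hle, hq⟩
    have hfq : f ∈ q := hle (Ideal.mem_sup_right (Ideal.mem_span_singleton_self f))
    have := eq_maximalIdeal_of_lt f p hfp hp q (lt_of_le_of_ne (le_sup_left.trans hle)
      fun h => hfp (h ▸ hfq))
    rw [this]
  have hzm : ∀ i, z i ∈ maximalIdeal A := fun i => by
    rw [hz]
    exact Ideal.le_radical (Ideal.mem_sup_right (Ideal.subset_span ⟨i, rfl⟩))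
  have hex : ∀ i, ∃ y ∈ p, ∃ (a : A) (e : ℕ), z i ^ e = y + a * f := fun i => by
    obtain ⟨e, he⟩ := hrad (hzm i)
    obtain ⟨y, hy, w, hw, h⟩ := Submodule.mem_sup.1 he
    obtain ⟨a, rfl⟩ := Ideal.mem_span_singleton'.1 hw
    exact ⟨y, hy, a, e, h.symm⟩
  choose y hy a e h using hex
  refine ⟨y, hy, ?_⟩
  have hf : f ∈ Ideal.span (Set.range (Fin.cons f y : Fin (d + 1) → A)) :=
    Ideal.subset_span ⟨0, rfl⟩
  conv_lhs => rw [hz]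
  rw [Ideal.radical_le_radical_iff]
  refine sup_le ?_ ?_
  · rw [Ideal.span_le, Set.singleton_subset_iff]
    exact Ideal.le_radical hf
  · rw [Ideal.span_le]
    rintro _ ⟨i, rfl⟩
    refine ⟨e i, ?_⟩
    rw [h i]
    exact add_mem (Ideal.subset_span ⟨i.succ, rfl⟩) (Ideal.mul_mem_left _ _ hf)

/-! ### Extension and uniqueness of derivations in finite extensions -/

theorem Derivation.exists_extension_of_formallyEtale {R S T M : Type*} [CommRing R] [CommRing S]
    [CommRing T] [Algebra R S] [Algebra R T] [Algebra S T] [IsScalarTower R S T]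
    [Algebra.FormallyEtale S T] [AddCommGroup M] [Module R M] [Module S M] [Module T M]
    [IsScalarTower S T M] [IsScalarTower R S M] [IsScalarTower R T M] (D : Derivation R S M) :
    ∃ D' : Derivation R T M, ∀ s, D' (algebraMap S T s) = D s := by
  have hb := KaehlerDifferential.isBaseChange_of_formallyEtale R S T
  let g : Ω[T⁄R] →ₗ[T] M := hb.lift D.liftKaehlerDifferential
  refine ⟨g.compDer (KaehlerDifferential.D R T), fun s => ?_⟩
  have h := hb.lift_eq D.liftKaehlerDifferential (KaehlerDifferential.D R S s)
  rw [KaehlerDifferential.map_D, Derivation.liftKaehlerDifferential_comp_D] at h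
  exact h

theorem FractionRing.formallyEtale_of_finite {B A : Type*} [CommRing B] [IsDomain B] [CharZero B]
    [CommRing A] [IsDomain A] [Algebra B A] [FaithfulSMul B A] [Module.Finite B A] :
    Algebra.FormallyEtale B (FractionRing A) := by
  let K := FractionRing B
  let L := FractionRing A
  let _ : Algebra K L := FractionRing.liftAlgebra B L
  have : IsScalarTower B K L := FractionRing.isScalarTower_liftAlgebra B L
  have : CharZero K := charZero_of_injective_algebraMap (IsFractionRing.injective B K)
  have hB : Algebra.IsAlgebraic B L :=
    have : Algebra.IsAlgebraic A L := IsFractionRing.comap_isAlgebraic_iff (K := L).2 inferInstance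
    Algebra.IsAlgebraic.trans B A L
  have : Algebra.IsAlgebraic K L := IsFractionRing.comap_isAlgebraic_iff.1 hB
  have : Algebra.IsSeparable K L := inferInstance
  have : Algebra.FormallyEtale K L := Algebra.FormallyEtale.of_isSeparable K L
  have : Algebra.FormallyEtale B K := Algebra.FormallyEtale.of_isLocalization (nonZeroDivisors B)
  exact Algebra.FormallyEtale.comp B K L

/-- A derivation of `B` extends to a finite extension `A` of domains of characteristic zero after
multiplication by some `c ≠ 0`: extend it to the fraction field of `A`, which is formally étale over
`B`, and clear the denominators of its values on generators. -/
theorem Derivation.exists_smul_extension_of_finite {R B A : Type*} [CommRing R] [CommRing B]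
    [IsDomain B] [CharZero B] [CommRing A] [IsDomain A] [Algebra R B] [Algebra R A] [Algebra B A]
    [IsScalarTower R B A] [FaithfulSMul B A] [Module.Finite B A] (D : Derivation R B B) :
    ∃ c : A, c ≠ 0 ∧ ∃ E : Derivation R A A,
      ∀ b, E (algebraMap B A b) = c * algebraMap B A (D b) := by
  classical
  let L := FractionRing A
  have := FractionRing.formallyEtale_of_finite (B := B) (A := A)
  obtain ⟨D', hD'⟩ := Derivation.exists_extension_of_formallyEtale (T := L)
    ((Algebra.linearMap B L).compDer D)
  obtain ⟨s, hs⟩ := Module.Finite.fg_top (R := B) (M := A)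
  obtain ⟨⟨c, hc⟩, hcs⟩ := IsLocalization.exist_integer_multiples_of_finset (nonZeroDivisors A)
    (s.image fun a => D' (algebraMap A L a))
  have hD'' : ∀ b, D' (algebraMap A L (algebraMap B A b)) = algebraMap A L (algebraMap B A (D b)) :=
    fun b => by
      rw [← IsScalarTower.algebraMap_apply B A L, hD', ← IsScalarTower.algebraMap_apply B A L]
      rfl
  have hleib : ∀ u v : L, D' (u * v) = u * D' v + v * D' u := D'.leibniz
  have hint : ∀ a : A, ∃ a' : A, algebraMap A L a' = algebraMap A L c * D' (algebraMap A L a) := by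
    intro a
    have ha : a ∈ Submodule.span B (s : Set A) := hs ▸ Submodule.mem_top
    induction ha using Submodule.span_induction with
    | mem x hx =>
      obtain ⟨x', hx'⟩ := hcs _ (Finset.mem_image_of_mem _ hx)
      exact ⟨x', hx'.trans (Algebra.smul_def _ _)⟩
    | zero => exact ⟨0, by simp⟩
    | add x y _ _ hx hy =>
      obtain ⟨x', hx'⟩ := hx
      obtain ⟨y', hy'⟩ := hy
      exact ⟨x' + y', by rw [map_add, hx', hy', map_add, map_add, mul_add]⟩
    | smul b x _ hx =>
      obtain ⟨x', hx'⟩ := hx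
      refine ⟨algebraMap B A b * x' + c * x * algebraMap B A (D b), ?_⟩
      rw [Algebra.smul_def, map_mul (algebraMap A L) _ x, hleib, hD'']
      simp only [map_add, map_mul, hx']
      ring
  have hinj := IsFractionRing.injective A L
  choose g hg using hint
  refine ⟨c, nonZeroDivisors.ne_zero hc, Derivation.mk' ⟨⟨g, fun a b => hinj ?_⟩, fun r a => hinj ?_⟩
    fun a b => hinj ?_, fun b => hinj ?_⟩
  · simp only [hg, map_add, mul_add]
  · simp only [hg, RingHom.id_apply, Algebra.smul_def r, map_mul, hleib]
    rw [← IsScalarTower.algebraMap_apply R A L, D'.map_algebraMap]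
    ring
  · change algebraMap A L (g (a * b)) = algebraMap A L (a * g b + b * g a)
    simp only [hg, map_add, map_mul, hleib]
    ring
  · change algebraMap A L (g _) = _
    rw [hg, map_mul, hD'']

/-- A common factor `c` works for finitely many derivations. -/
theorem Derivation.exists_smul_extensions_of_finite {R B A : Type*} [CommRing R] [CommRing B]
    [IsDomain B] [CharZero B] [CommRing A] [IsDomain A] [Algebra R B] [Algebra R A] [Algebra B A]
    [IsScalarTower R B A] [FaithfulSMul B A] [Module.Finite B A] {ι : Type*} [Fintype ι]
    (D : ι → Derivation R B B) : ∃ c : A, c ≠ 0 ∧ ∃ E : ι → Derivation R A A,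
      ∀ i b, E i (algebraMap B A b) = c * algebraMap B A (D i b) := by
  classical
  choose c hc E hE using fun i => Derivation.exists_smul_extension_of_finite (A := A) (D i)
  refine ⟨∏ i, c i, Finset.prod_ne_zero_iff.2 fun i _ => hc i,
    fun i => (∏ j ∈ Finset.univ.erase i, c j) • E i, fun i b => ?_⟩
  rw [Derivation.smul_apply, hE, smul_eq_mul, ← mul_assoc,
    Finset.prod_erase_mul _ _ (Finset.mem_univ i)]

/-- A derivation into a torsion-free module which vanishes on `B` vanishes on every algebraic
extension `A` of `B`: differentiate a polynomial of minimal degree which kills `a`. -/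
theorem Derivation.eq_zero_of_isAlgebraic {B A M : Type*} [CommRing B] [IsDomain B] [CharZero B]
    [CommRing A] [IsDomain A] [Algebra B A] [FaithfulSMul B A] [Algebra.IsAlgebraic B A]
    [AddCommGroup M] [Module A M] [Module.IsTorsionFree A M] (D : Derivation ℤ A M)
    (hD : ∀ b, D (algebraMap B A b) = 0) : D = 0 := by
  classical
  let _ : Module B M := Module.compHom M (algebraMap B A)
  have : IsScalarTower B A M := ⟨fun b a m => by
    rw [Algebra.smul_def, mul_smul]; rfl⟩
  let D' : Derivation B A M := Derivation.mk' ⟨⟨D, D.map_add⟩, fun b a => by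
    change D (b • a) = algebraMap B A b • D a
    rw [Algebra.smul_def, D.leibniz, hD, smul_zero, add_zero]⟩ fun a b => D.leibniz a b
  ext a
  have hex : ∃ n : ℕ, ∃ P : Polynomial B, P.natDegree = n ∧ P ≠ 0 ∧ Polynomial.aeval a P = 0 := by
    obtain ⟨P, hP, h⟩ := Algebra.IsAlgebraic.isAlgebraic (R := B) a
    exact ⟨_, P, rfl, hP, h⟩
  obtain ⟨P, hPn, hP0, hPa⟩ := Nat.find_spec hex
  have hmin := fun m (hm : m < Nat.find hex) => Nat.find_min hex hm
  have hdeg : P.natDegree ≠ 0 := by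
    intro h0
    rw [Polynomial.eq_C_of_natDegree_eq_zero h0, Polynomial.aeval_C,
      FaithfulSMul.algebraMap_eq_zero_iff] at hPa
    exact hP0 (by rw [Polynomial.eq_C_of_natDegree_eq_zero h0, hPa, map_zero])
  have hder : Polynomial.aeval a (Polynomial.derivative P) ≠ 0 := by
    intro h
    refine hmin _ ?_ ⟨Polynomial.derivative P, rfl, ?_, h⟩
    · rw [← hPn]; exact Polynomial.natDegree_derivative_lt hdeg
    · intro h0
      exact hdeg (Polynomial.derivative_eq_zero.1 h0)
  have h : D' (Polynomial.aeval a P) = _ := D'.map_aeval P a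
  rw [hPa, map_zero] at h
  exact (smul_eq_zero.1 h.symm).resolve_left hder

/-! ### Derivations relative to a power series subring -/

theorem mvPowerSeries_span_succ_map {k A : Type*} [Field k] [CommRing A] [Algebra k A] {I : Ideal A}
    [IsAdicComplete I A] {d : ℕ} {f : A} {y : Fin d → A}
    (hx : ∀ i, (Fin.cons f y : Fin (d + 1) → A) i ∈ I) :
    (Ideal.span (Set.range fun i : Fin d =>
      (MvPowerSeries.X i.succ : MvPowerSeries (Fin (d + 1)) k))).map
        (mvPowerSeriesEval k I (Fin.cons f y) hx) = Ideal.span (Set.range y) := by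
  rw [Ideal.map_span, ← Set.range_comp]
  congr 2
  ext i
  exact mvPowerSeriesEval_X k I _ hx i.succ

theorem mem_powerSeriesSubring_of_eval {k A : Type*} [Field k] [CommRing A] [Algebra k A]
    {I : Ideal A} [IsAdicComplete I A] {d : ℕ} {f : A} {y : Fin d → A}
    (hf : f ∈ I) (hx : ∀ i, (Fin.cons f y : Fin (d + 1) → A) i ∈ I) (p : k⟦X⟧) :
    mvPowerSeriesEval k I (Fin.cons f y) hx (p.toMvPowerSeries 0) ∈ powerSeriesSubring k I f hf :=
  ⟨p, (mvPowerSeriesEval_toMvPowerSeries k I _ hx 0 p).symm⟩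

/-- For a system of parameters `f, y` there are `k⟦f⟧`-derivations `E` of `A` which up to a common
factor `c ≠ 0` are dual to `y`: extend the partial derivatives of the power series ring. -/
theorem exists_dual_derivations {A k : Type*} [CommRing A] [IsDomain A] [IsNoetherianRing A]
    [IsLocalRing A] [IsAdicComplete (IsLocalRing.maximalIdeal A) A] [Field k] [CharZero k]
    [Algebra k A] (hk : Function.Surjective ((IsLocalRing.residue A).comp (algebraMap k A)))
    {d : ℕ} (hdim : ringKrullDim A = ((d + 1 : ℕ) : WithBot ℕ∞)) {f : A}
    (hf : f ∈ IsLocalRing.maximalIdeal A) {y : Fin d → A}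
    (hy : ∀ i, y i ∈ IsLocalRing.maximalIdeal A)
    (hrad : IsLocalRing.maximalIdeal A ≤
      (Ideal.span (Set.range (Fin.cons f y : Fin (d + 1) → A))).radical) :
    ∃ c : A, c ≠ 0 ∧ ∃ E : Fin d → Derivation
        (powerSeriesSubring k (IsLocalRing.maximalIdeal A) f hf) A A,
      ∀ i j, E i (y j) = if i = j then c else 0 := by
  have hx : ∀ i, (Fin.cons f y : Fin (d + 1) → A) i ∈ IsLocalRing.maximalIdeal A :=
    Fin.cases hf hy
  set φ := mvPowerSeriesEval k (IsLocalRing.maximalIdeal A) (Fin.cons f y) hx with hφ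
  have hinj : Function.Injective φ := mvPowerSeriesEval_injective hdim _ hx hrad
  let _ : Algebra (MvPowerSeries (Fin (d + 1)) k) A := φ.toAlgebra
  have : IsScalarTower k (MvPowerSeries (Fin (d + 1)) k) A :=
    IsScalarTower.of_algebraMap_eq fun c => (mvPowerSeriesEval_C k _ _ hx c).symm
  have : Module.Finite (MvPowerSeries (Fin (d + 1)) k) A := mvPowerSeriesEval_finite hk _ hx hrad
  have : FaithfulSMul (MvPowerSeries (Fin (d + 1)) k) A :=
    (faithfulSMul_iff_algebraMap_injective _ _).2 hinj
  have : IsDomain (MvPowerSeries (Fin (d + 1)) k) := NoZeroDivisors.to_isDomain _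
  have : CharZero (MvPowerSeries (Fin (d + 1)) k) :=
    charZero_of_injective_algebraMap (FaithfulSMul.algebraMap_injective k _)
  obtain ⟨c, hc, E, hE⟩ := Derivation.exists_smul_extensions_of_finite (A := A)
    fun i : Fin d => MvPowerSeries.pderiv k i.succ
  have hEφ : ∀ i b, E i (φ b) = c * φ (MvPowerSeries.pderiv k i.succ b) := hE
  -- `E i` is linear over `k⟦f⟧` since the partial derivatives kill power series in `X 0`
  refine ⟨c, hc, fun i => Derivation.mk' ⟨⟨E i, (E i).map_add⟩, fun t a => ?_⟩
    fun a b => (E i).leibniz a b, fun i j => ?_⟩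
  · obtain ⟨t, p, rfl⟩ := t
    change E i (powerSeriesEval k _ f hf p * a) = powerSeriesEval k _ f hf p * E i a
    have hp : φ (p.toMvPowerSeries 0) = powerSeriesEval k _ f hf p :=
      mvPowerSeriesEval_toMvPowerSeries k _ _ hx 0 p
    rw [(E i).leibniz, ← hp, hEφ, MvPowerSeries.pderiv_toMvPowerSeries (Fin.succ_ne_zero i)]
    simp
  · change E i (y j) = _
    have := hEφ i (MvPowerSeries.X j.succ)
    rw [mvPowerSeriesEval_X] at this
    change E i (y j) = _ at this
    rw [this]
    classical
    rw [MvPowerSeries.pderiv_X]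
    by_cases h : i = j
    · subst h; simp
    · rw [if_neg h, Pi.single_eq_of_ne, map_zero, mul_zero]
      simpa [eq_comm] using h

theorem Derivation.eq_zero_of_isHausdorff_of_isAlgebraic {B A M : Type*} [CommRing B] [IsDomain B]
    [CharZero B] [CommRing A] [IsDomain A] [Algebra B A] [FaithfulSMul B A]
    [Algebra.IsAlgebraic B A] [AddCommGroup M] [Module A M] [Module.IsTorsionFree A M]
    (D : Derivation ℤ A M) (s : Set B)
    (hM : IsHausdorff ((Ideal.span s).map (algebraMap B A)) M)
    (hs : ∀ x ∈ s, D (algebraMap B A x) = 0)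
    (hB : ∀ b, ∃ c ∈ Ideal.span s, D (algebraMap B A b) = D (algebraMap B A c)) : D = 0 := by
  let _ : Module B M := Module.compHom M (algebraMap B A)
  have : IsScalarTower B A M := ⟨fun b a m => by
    rw [Algebra.smul_def, mul_smul]; rfl⟩
  have : IsHausdorff (Ideal.span s) M := IsHausdorff.map_algebraMap_iff.1 hM
  have h0 := (D.compAlgebraMap B).eq_zero_of_isHausdorff s hs fun b => by
    obtain ⟨c, hc, h⟩ := hB b
    exact ⟨1, isUnit_one, c, hc, by rw [one_smul]; exact h⟩
  exact D.eq_zero_of_isAlgebraic (B := B) fun b => congrArg (fun E => E b) h0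

/-- A derivation of `A` which vanishes on `k⟦f⟧` and on `y`, where `f, y` is a system of parameters,
is zero on the power series ring in `f, y`, as its target is `(y)`-adically separated, and then on
`A`, which is algebraic over this ring. -/
theorem Derivation.eq_zero_of_parameters {A k : Type*} [CommRing A] [IsDomain A]
    [IsNoetherianRing A] [IsLocalRing A] [IsAdicComplete (IsLocalRing.maximalIdeal A) A] [Field k]
    [CharZero k] [Algebra k A]
    (hk : Function.Surjective ((IsLocalRing.residue A).comp (algebraMap k A)))
    {d : ℕ} (hdim : ringKrullDim A = ((d + 1 : ℕ) : WithBot ℕ∞)) {f : A}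
    (hf : f ∈ IsLocalRing.maximalIdeal A) {y : Fin d → A}
    (hy : ∀ i, y i ∈ IsLocalRing.maximalIdeal A)
    (hrad : IsLocalRing.maximalIdeal A ≤
      (Ideal.span (Set.range (Fin.cons f y : Fin (d + 1) → A))).radical)
    {M : Type*} [AddCommGroup M] [Module A M] [Module.IsTorsionFree A M]
    [IsHausdorff (Ideal.span (Set.range y)) M] (D : Derivation ℤ A M)
    (hDT : ∀ t ∈ powerSeriesSubring k (IsLocalRing.maximalIdeal A) f hf, D t = 0)
    (hDy : ∀ i, D (y i) = 0) : D = 0 := by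
  have hx : ∀ i, (Fin.cons f y : Fin (d + 1) → A) i ∈ IsLocalRing.maximalIdeal A :=
    Fin.cases hf hy
  set φ := mvPowerSeriesEval k (IsLocalRing.maximalIdeal A) (Fin.cons f y) hx with hφ
  have hinj : Function.Injective φ := mvPowerSeriesEval_injective hdim _ hx hrad
  let _ : Algebra (MvPowerSeries (Fin (d + 1)) k) A := φ.toAlgebra
  have : Module.Finite (MvPowerSeries (Fin (d + 1)) k) A := mvPowerSeriesEval_finite hk _ hx hrad
  have : FaithfulSMul (MvPowerSeries (Fin (d + 1)) k) A :=
    (faithfulSMul_iff_algebraMap_injective _ _).2 hinj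
  have : IsDomain (MvPowerSeries (Fin (d + 1)) k) := NoZeroDivisors.to_isDomain _
  have : CharZero (MvPowerSeries (Fin (d + 1)) k) :=
    charZero_of_injective_algebraMap (FaithfulSMul.algebraMap_injective k _)
  refine D.eq_zero_of_isHausdorff_of_isAlgebraic
    (Set.range fun i : Fin d => (MvPowerSeries.X i.succ : MvPowerSeries (Fin (d + 1)) k)) ?_ ?_ ?_
  · change IsHausdorff (Ideal.map φ _) M
    rw [mvPowerSeries_span_succ_map]
    infer_instance
  · rintro _ ⟨i, rfl⟩
    change D (φ (MvPowerSeries.X i.succ)) = 0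
    rw [mvPowerSeriesEval_X]
    exact hDy i
  · intro b
    obtain ⟨p, hp⟩ := MvPowerSeries.exists_sub_toMvPowerSeries_mem b
    refine ⟨_, hp, ?_⟩
    change D (φ b) = D (φ _)
    rw [map_sub, map_sub, hDT _ (mem_powerSeriesSubring_of_eval hf hx p), sub_zero]

/-- If `f, y` is a system of parameters and `p` contains `y`, then `A / p` is integral over
`k⟦f⟧`. -/
theorem isIntegral_mk_of_parameters_mem {A k : Type*} [CommRing A]
    [IsNoetherianRing A] [IsLocalRing A] [IsAdicComplete (IsLocalRing.maximalIdeal A) A] [Field k]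
    [Algebra k A] (hk : Function.Surjective ((IsLocalRing.residue A).comp (algebraMap k A)))
    {d : ℕ} {f : A} (hf : f ∈ IsLocalRing.maximalIdeal A) {y : Fin d → A}
    (hrad : IsLocalRing.maximalIdeal A ≤
      (Ideal.span (Set.range (Fin.cons f y : Fin (d + 1) → A))).radical)
    (p : Ideal A) [p.IsPrime] (hy : ∀ i, y i ∈ p) (a : A) :
    IsIntegral (powerSeriesSubring k (IsLocalRing.maximalIdeal A) f hf)
      (Ideal.Quotient.mk p a) := by
  have hym : ∀ i, y i ∈ IsLocalRing.maximalIdeal A := fun i =>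
    IsLocalRing.le_maximalIdeal (Ideal.IsPrime.ne_top ‹_›) (hy i)
  have hx : ∀ i, (Fin.cons f y : Fin (d + 1) → A) i ∈ IsLocalRing.maximalIdeal A :=
    Fin.cases hf hym
  set φ := mvPowerSeriesEval k (IsLocalRing.maximalIdeal A) (Fin.cons f y) hx with hφ
  obtain ⟨P, hP, hPa⟩ := (mvPowerSeriesEval_finite hk _ hx hrad).to_isIntegral a
  have hlift : P.map ((Ideal.Quotient.mk p).comp φ) ∈ Polynomial.lifts
      (algebraMap (powerSeriesSubring k (IsLocalRing.maximalIdeal A) f hf) (A ⧸ p)) := by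
    rw [Polynomial.lifts_iff_coeff_lifts]
    intro n
    rw [Polynomial.coeff_map]
    obtain ⟨q, hq⟩ := MvPowerSeries.exists_sub_toMvPowerSeries_mem (P.coeff n)
    refine ⟨⟨_, mem_powerSeriesSubring_of_eval hf hx q⟩, ?_⟩
    change Ideal.Quotient.mk p (φ _) = Ideal.Quotient.mk p (φ _)
    rw [eq_comm, Ideal.Quotient.eq, ← map_sub]
    have h1 := Ideal.mem_map_of_mem φ hq
    rw [mvPowerSeries_span_succ_map] at h1
    have h2 : Ideal.span (Set.range y) ≤ p := by
      rw [Ideal.span_le]; rintro _ ⟨i, rfl⟩; exact hy i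
    exact h2 h1
  obtain ⟨Q, hQ, -, hQm⟩ := Polynomial.lifts_and_natDegree_eq_and_monic hlift (hP.map _)
  refine ⟨Q, hQm, ?_⟩
  rw [← Polynomial.eval_map, hQ, Polynomial.eval_map, ← Polynomial.hom_eval₂, hPa, map_zero]

/-! ### Localization of modules of derivations -/

/-- If `D` maps `A` into a finitely generated `A`-submodule of the fraction field, namely into a
multiple of `c⁻¹ A`, and into the localization `S = W⁻¹ A`, then a single denominator in `W` serves
all values of `D`: the elements of `c⁻¹ A` which lie in `S` form a finitely generated module. -/
theorem IsLocalization.exists_mul_mem_of_forall {A S ι : Type*} [CommRing A] [IsNoetherianRing A]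
    [CommRing S] [IsDomain S] [Algebra A S] (W : Submonoid A) [IsLocalization W S] [Fintype ι]
    {c : A} (hc : algebraMap A S c ≠ 0) (s : ι → S) (e : ι → A → A) (D : A → S)
    (h : ∀ a, algebraMap A S c * D a = ∑ i, s i * algebraMap A S (e i a)) :
    ∃ w ∈ W, ∀ a, ∃ a', algebraMap A S w * D a = algebraMap A S a' := by
  classical
  obtain ⟨⟨w₀, hw₀⟩, h₀⟩ := IsLocalization.exist_integer_multiples W Finset.univ s
  choose s' hs' using fun i => h₀ i (Finset.mem_univ i)
  -- the numerators of the elements of `c⁻¹ A` which lie in `S`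
  let I : Ideal A := (Ideal.span {algebraMap A S c}).comap (algebraMap A S)
  obtain ⟨t, ht⟩ := IsNoetherian.noetherian I
  have hz : ∀ x ∈ t, ∃ z : S, algebraMap A S x = algebraMap A S c * z := fun x hx =>
    Ideal.mem_span_singleton.1 (show x ∈ I from ht ▸ Submodule.subset_span hx)
  choose! z hz using hz
  obtain ⟨⟨w₁, hw₁⟩, h₁⟩ := IsLocalization.exist_integer_multiples W t z
  have key : ∀ x ∈ I, ∃ a' : A, algebraMap A S w₁ * algebraMap A S x =
      algebraMap A S c * algebraMap A S a' := by
    intro x hx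
    rw [← ht] at hx
    induction hx using Submodule.span_induction with
    | mem x hx =>
      obtain ⟨a', ha'⟩ := h₁ x hx
      refine ⟨a', ?_⟩
      rw [ha', Algebra.smul_def, hz x hx]
      ring
    | zero => exact ⟨0, by simp⟩
    | add x y _ _ hx hy =>
      obtain ⟨a, ha⟩ := hx
      obtain ⟨b, hb⟩ := hy
      exact ⟨a + b, by rw [map_add, mul_add, ha, hb, map_add, mul_add]⟩
    | smul r x _ hx =>
      obtain ⟨a, ha⟩ := hx
      refine ⟨r * a, ?_⟩
      rw [smul_eq_mul, map_mul, mul_left_comm, ha, map_mul]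
      ring
  refine ⟨w₁ * w₀, W.mul_mem hw₁ hw₀, fun a => ?_⟩
  have hx : algebraMap A S (∑ i, s' i * e i a) =
      algebraMap A S c * (algebraMap A S w₀ * D a) := by
    rw [mul_left_comm, h, map_sum, Finset.mul_sum]
    refine Finset.sum_congr rfl fun i _ => ?_
    rw [map_mul, hs', Algebra.smul_def, mul_assoc]
  obtain ⟨a', ha'⟩ := key _ (Ideal.mem_span_singleton.2 ⟨_, hx⟩)
  refine ⟨a', mul_left_cancel₀ hc ?_⟩
  rw [← ha', hx, map_mul]
  ring

theorem Derivation.ext_of_isLocalization {R A S M : Type*} [CommRing R] [CommRing A] [CommRing S]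
    [Algebra R S] [Algebra A S] (W : Submonoid A) [IsLocalization W S] [AddCommGroup M] [Module S M]
    [Module R M] {D₁ D₂ : Derivation R S M}
    (h : ∀ a, D₁ (algebraMap A S a) = D₂ (algebraMap A S a)) : D₁ = D₂ := by
  ext s
  obtain ⟨⟨a, w⟩, ha⟩ := IsLocalization.surj W s
  have h1 := D₁.leibniz s (algebraMap A S w)
  have h2 := D₂.leibniz s (algebraMap A S w)
  dsimp only at ha
  rw [ha, h, h] at h1
  rw [ha, h1, add_right_inj] at h2
  exact ((IsLocalization.map_units S w).smul_left_cancel).1 h2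

/-- `Der_{T₁}(W⁻¹ A)` is the localization of `Der_{T₀}(A)` if the two base rings impose the same
conditions (`h₁`, `h₂`) and each derivation of `A` into `W⁻¹ A` has a bounded denominator
(`h₃`). -/
theorem Derivation.exists_isLocalizedModule {A S T₀ T₁ : Type*} [CommRing A] [CommRing S]
    [CommRing T₀] [CommRing T₁] [Algebra A S] [Algebra T₀ A] [Algebra T₁ S] [SMulCommClass T₁ A S]
    (W : Submonoid A) [IsLocalization W S] (hinj : Function.Injective (algebraMap A S))
    (h₁ : ∀ D : Derivation ℤ S S, (∀ t, D (algebraMap A S (algebraMap T₀ A t)) = 0) →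
      ∀ t, D (algebraMap T₁ S t) = 0)
    (h₂ : ∀ t, ∃ t', algebraMap A S (algebraMap T₀ A t) = algebraMap T₁ S t')
    (h₃ : ∀ D : Derivation ℤ A S, (∀ t, D (algebraMap T₀ A t) = 0) →
      ∃ w ∈ W, ∀ a, ∃ a', algebraMap A S w * D a = algebraMap A S a') :
    ∃ Φ : Derivation T₀ A A →ₗ[A] Derivation T₁ S S,
      (∀ D a, Φ D (algebraMap A S a) = algebraMap A S (D a)) ∧ IsLocalizedModule W Φ := by
  have hext : ∀ D : Derivation T₀ A A, ∃ E : Derivation T₁ S S,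
      ∀ a, E (algebraMap A S a) = algebraMap A S (D a) := by
    intro D
    have := Algebra.FormallyEtale.of_isLocalization (R := A) (Rₘ := S) W
    obtain ⟨E, hE⟩ := Derivation.exists_extension_of_formallyEtale (T := S)
      ((Algebra.linearMap A S).compDer (D.restrictScalars ℤ))
    have hE' : ∀ a, E (algebraMap A S a) = algebraMap A S (D a) := hE
    have hE0 := h₁ E fun t => by rw [hE', D.map_algebraMap, map_zero]
    refine ⟨Derivation.mk' ⟨⟨E, E.map_add⟩, fun t s => ?_⟩ fun a b => E.leibniz a b, hE'⟩
    change E (t • s) = t • E s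
    rw [Algebra.smul_def, E.leibniz, hE0, smul_zero, add_zero, algebraMap_smul]
  choose Φ hΦ using hext
  let Φ' : Derivation T₀ A A →ₗ[A] Derivation T₁ S S :=
    { toFun := Φ
      map_add' := fun D E => Derivation.ext_of_isLocalization W fun a => by
        rw [Derivation.add_apply, hΦ, hΦ, hΦ, Derivation.add_apply, map_add]
      map_smul' := fun r D => Derivation.ext_of_isLocalization W fun a => by
        rw [RingHom.id_apply, Derivation.smul_apply, hΦ, hΦ, Derivation.smul_apply, smul_eq_mul,
          map_mul, Algebra.smul_def] }
  refine ⟨Φ', hΦ, ⟨fun w => ?_, fun E => ?_, fun {D E} h => ⟨1, ?_⟩⟩⟩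
  · have hu := IsLocalization.map_units S w
    rw [Module.End.isUnit_iff]
    constructor
    · intro E F h
      ext s
      have := congrArg (fun G => G s) h
      change (w : A) • E s = (w : A) • F s at this
      rw [Algebra.smul_def, Algebra.smul_def] at this
      exact hu.mul_left_cancel this
    · intro E
      obtain ⟨u, hu⟩ := hu
      refine ⟨(↑u⁻¹ : S) • E, ?_⟩
      ext s
      change (w : A) • ((↑u⁻¹ : S) • E s) = E s
      rw [Algebra.smul_def, ← hu, smul_eq_mul, Units.mul_inv_cancel_left]
  · -- `w • E` maps `A` into `A`
    have hE0 : ∀ t, E (algebraMap A S (algebraMap T₀ A t)) = 0 := fun t => by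
      obtain ⟨t', ht'⟩ := h₂ t
      rw [ht', E.map_algebraMap]
    let E' : Derivation ℤ A S := (E.restrictScalars ℤ).compAlgebraMap A
    obtain ⟨w, hw, h⟩ := h₃ E' hE0
    choose g hg using h
    have hg' : ∀ a, algebraMap A S w * E (algebraMap A S a) = algebraMap A S (g a) := hg
    refine ⟨⟨Derivation.mk' ⟨⟨g, fun a b => hinj ?_⟩, fun r a => hinj ?_⟩ fun a b => hinj ?_,
      ⟨w, hw⟩⟩, Derivation.ext_of_isLocalization W fun a => ?_⟩
    · rw [map_add, ← hg', ← hg', ← hg', map_add, map_add, mul_add]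
    · rw [RingHom.id_apply, Algebra.smul_def, Algebra.smul_def, map_mul, ← hg', ← hg', map_mul,
        E.leibniz, hE0, smul_zero, add_zero, smul_eq_mul, mul_left_comm]
    · change algebraMap A S (g (a * b)) = algebraMap A S (a * g b + b * g a)
      rw [map_add, map_mul, map_mul, ← hg', ← hg', ← hg', map_mul, E.leibniz]
      simp only [smul_eq_mul]
      ring
    · change w • E (algebraMap A S a) = Φ _ (algebraMap A S a)
      rw [hΦ, Algebra.smul_def, hg']
      rfl
  · rw [one_smul, one_smul]
    ext a
    have := congrArg (fun G => G (algebraMap A S a)) h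
    change Φ D _ = Φ E _ at this
    rw [hΦ, hΦ] at this
    exact hinj this

/-! ### The subrings `k⟦f⟧` and `k((f))` -/

section Subrings

variable {k A : Type*} [Field k] [CommRing A] [Algebra k A] {I : Ideal A} [IsAdicComplete I A]
  {f : A} {hf : f ∈ I} {R : Type*} [CommRing R] [Algebra A R] [IsLocalization.Away f R]

theorem laurentSeriesEval_algebraMap (p : k⟦X⟧) : laurentSeriesEval k I f hf R
    (algebraMap k⟦X⟧ k⸨X⸩ p) = algebraMap A R (powerSeriesEval k I f hf p) :=
  IsLocalization.Away.lift_eq (S := k⸨X⸩) (PowerSeries.X : k⟦X⟧)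
    (g := (algebraMap A R).comp (powerSeriesEval k I f hf)) _ p

theorem mem_powerSeriesSubring : f ∈ powerSeriesSubring k I f hf :=
  ⟨PowerSeries.X, powerSeriesEval_X k I f hf⟩

theorem algebraMap_mem_laurentSeriesSubring {t : A} (ht : t ∈ powerSeriesSubring k I f hf) :
    algebraMap A R t ∈ laurentSeriesSubring k I f hf R := by
  obtain ⟨p, rfl⟩ := ht
  exact ⟨_, laurentSeriesEval_algebraMap p⟩

theorem exists_mul_eq_of_mem_laurentSeriesSubring {x : R}
    (hx : x ∈ laurentSeriesSubring k I f hf R) :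
    ∃ n : ℕ, ∃ t ∈ powerSeriesSubring k I f hf, x * algebraMap A R f ^ n = algebraMap A R t := by
  obtain ⟨q, rfl⟩ := hx
  obtain ⟨⟨p, w⟩, hp⟩ := IsLocalization.surj (Submonoid.powers (PowerSeries.X : k⟦X⟧)) q
  obtain ⟨_, n, rfl⟩ := w
  refine ⟨n, _, ⟨p, rfl⟩, ?_⟩
  have := congrArg (laurentSeriesEval k I f hf R) hp
  rw [map_mul, laurentSeriesEval_algebraMap, laurentSeriesEval_algebraMap] at this
  dsimp only at this
  rwa [map_pow, powerSeriesEval_X, map_pow] at this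

theorem exists_inv_mem_laurentSeriesSubring :
    ∃ g ∈ laurentSeriesSubring k I f hf R, algebraMap A R f * g = 1 := by
  refine ⟨_, ⟨(algebraMap k⟦X⟧ k⸨X⸩ PowerSeries.X)⁻¹, rfl⟩, ?_⟩
  have h := laurentSeriesEval_algebraMap (hf := hf) (R := R) (PowerSeries.X : k⟦X⟧)
  rw [powerSeriesEval_X] at h
  rw [← h, ← map_mul, mul_inv_cancel₀, map_one]
  exact (IsLocalization.Away.algebraMap_isUnit (S := k⸨X⸩) (PowerSeries.X : k⟦X⟧)).ne_zero

theorem isUnit_natCast_laurentSeriesSubring [CharZero k] (n : ℕ) (hn : n ≠ 0) :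
    IsUnit (n : laurentSeriesSubring k I f hf R) := by
  have : CharZero k⸨X⸩ :=
    charZero_of_injective_ringHom (HahnSeries.C : k →+* k⸨X⸩).injective
  have h : IsUnit (n : k⸨X⸩) := isUnit_iff_ne_zero.2 (Nat.cast_ne_zero.2 hn)
  have := h.map (laurentSeriesEval k I f hf R).rangeRestrict
  rwa [map_natCast] at this

theorem charZero_laurentSeriesSubring [CharZero k] [Nontrivial R] :
    CharZero (laurentSeriesSubring k I f hf R) := by
  have : CharZero k⸨X⸩ :=
    charZero_of_injective_ringHom (HahnSeries.C : k →+* k⸨X⸩).injective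
  exact charZero_of_injective_ringHom (laurentSeriesEval k I f hf R).rangeRestrict.injective

theorem Derivation.eq_zero_of_mem_laurentSeriesSubring {M : Type*} [AddCommGroup M] [Module R M]
    (D : Derivation ℤ R M)
    (hD : ∀ t ∈ powerSeriesSubring k I f hf, D (algebraMap A R t) = 0) (x : R)
    (hx : x ∈ laurentSeriesSubring k I f hf R) : D x = 0 := by
  obtain ⟨n, t, ht, h⟩ := exists_mul_eq_of_mem_laurentSeriesSubring hx
  have h1 := D.leibniz x (algebraMap A R f ^ n)
  have h2 : D (algebraMap A R f ^ n) = 0 := by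
    rw [← map_pow]; exact hD _ (pow_mem mem_powerSeriesSubring n)
  rw [h, hD t ht, h2, smul_zero, zero_add] at h1
  have hu : IsUnit (algebraMap A R f ^ n) := (IsLocalization.Away.algebraMap_isUnit f).pow n
  exact (hu.smul_eq_zero).1 h1.symm

end Subrings

/-! ### Expansion of derivations in terms of parameters -/

/-- A derivation `D` of `A` over `k⟦f⟧`, with values in a Noetherian domain `S`, is a combination of
the dual derivations: `c D = ∑ D (y i) E i`. Both sides agree on `y`; the proper ideal `Q` which
contains `y` makes `S` separated for the `(y)`-adic topology. -/
theorem Derivation.mul_apply_eq_sum_of_parameters {A k : Type*} [CommRing A] [IsDomain A]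
    [IsNoetherianRing A] [IsLocalRing A] [IsAdicComplete (IsLocalRing.maximalIdeal A) A] [Field k]
    [CharZero k] [Algebra k A]
    (hk : Function.Surjective ((IsLocalRing.residue A).comp (algebraMap k A)))
    {d : ℕ} (hdim : ringKrullDim A = ((d + 1 : ℕ) : WithBot ℕ∞)) {f : A}
    (hf : f ∈ IsLocalRing.maximalIdeal A) {y : Fin d → A}
    (hy : ∀ i, y i ∈ IsLocalRing.maximalIdeal A)
    (hrad : IsLocalRing.maximalIdeal A ≤
      (Ideal.span (Set.range (Fin.cons f y : Fin (d + 1) → A))).radical)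
    {c : A} {E : Fin d → Derivation (powerSeriesSubring k (IsLocalRing.maximalIdeal A) f hf) A A}
    (hE : ∀ i j, E i (y j) = if i = j then c else 0)
    {S : Type*} [CommRing S] [IsDomain S] [IsNoetherianRing S] [Algebra A S]
    (hinj : Function.Injective (algebraMap A S)) (Q : Ideal S) (hQ : Q ≠ ⊤)
    (hyQ : ∀ i, algebraMap A S (y i) ∈ Q) (D : Derivation ℤ A S)
    (hDT : ∀ t ∈ powerSeriesSubring k (IsLocalRing.maximalIdeal A) f hf, D t = 0) (a : A) :
    algebraMap A S c * D a = ∑ i, D (y i) * algebraMap A S (E i a) := by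
  let G : Derivation ℤ A S := c • D - ∑ i, D (y i) •
    (Algebra.linearMap A S).compDer ((E i).restrictScalars ℤ)
  have hG : ∀ a, G a = algebraMap A S c * D a - ∑ i, D (y i) * algebraMap A S (E i a) := by
    intro a
    change (c • D - ∑ i, D (y i) • _ : Derivation ℤ A S) a = _
    rw [Derivation.sub_apply, Derivation.sum_smul_apply, Derivation.smul_apply, Algebra.smul_def]
    rfl
  have : Module.IsTorsionFree A S := Module.isTorsionFree_iff_algebraMap_injective.2 hinj
  have : IsHausdorff (Ideal.span (Set.range y)) S := by
    rw [← IsHausdorff.map_algebraMap_iff (S := S)]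
    refine IsHausdorff.of_isDomain _ fun h => hQ (top_le_iff.1 (h ▸ ?_))
    rw [Ideal.map_span, Ideal.span_le]
    rintro _ ⟨_, ⟨i, rfl⟩, rfl⟩
    exact hyQ i
  have h0 : G = 0 := by
    refine Derivation.eq_zero_of_parameters hk hdim hf hy hrad G (fun t ht => ?_) fun j => ?_
    · rw [hG, hDT t ht, mul_zero, zero_sub, neg_eq_zero]
      refine Finset.sum_eq_zero fun i _ => ?_
      have : E i t = 0 := (E i).map_algebraMap (⟨t, ht⟩ : powerSeriesSubring k _ f hf)
      rw [this, map_zero, mul_zero]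
    · rw [hG, Finset.sum_eq_single j]
      · rw [hE, if_pos rfl, mul_comm, sub_self]
      · intro i _ hij
        rw [hE, if_neg hij, map_zero, mul_zero]
      · simp
  rw [← sub_eq_zero, ← hG, h0, Derivation.zero_apply]

/-! ### Maximal ideals of `A_f` -/

/-- The trace on `A` of a maximal ideal of `A_f` is maximal among the primes which do not contain
`f`. -/
theorem Ideal.mem_of_comap_lt {A R : Type*} [CommRing A] [CommRing R] [Algebra A R] {f : A}
    [IsLocalization.Away f R] (n : Ideal R) [hn : n.IsMaximal] (q : Ideal A) (hq : q.IsPrime)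
    (h : n.comap (algebraMap A R) < q) : f ∈ q := by
  by_contra hfq
  have hdisj : Disjoint (Submonoid.powers f : Set A) (q : Set A) := by
    rw [Set.disjoint_left]
    rintro _ ⟨m, rfl⟩ hm
    exact hfq (hq.mem_of_pow_mem m hm)
  have h1 := IsLocalization.isPrime_of_isPrime_disjoint (Submonoid.powers f) R q hq hdisj
  have h2 := IsLocalization.under_map_of_isPrime_disjoint (Submonoid.powers f) R hq hdisj
  have h3 : n ≤ q.map (algebraMap A R) := by
    rw [← IsLocalization.map_under (Submonoid.powers f) R n]
    exact Ideal.map_mono h.le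
  have h4 := hn.eq_of_le h1.ne_top h3
  rw [← h4] at h2
  exact h.ne h2

/-- If `A / p` is integral over `T`, where `p` is the trace on `A` of the maximal ideal `n` of `A_f`,
and the ring `l` contains the image of `T` and the inverse of `f`, then the residue field at `n` is
integral over `l`. -/
theorem isIntegral_residue_of_isIntegral_mk {A R T : Type*} [CommRing A] [CommRing R]
    [Algebra A R] [CommRing T] [Algebra T A] {f : A} [IsLocalization.Away f R] (l : Subring R)
    (hTl : ∀ t, algebraMap A R (algebraMap T A t) ∈ l)
    (hfl : ∃ g ∈ l, algebraMap A R f * g = 1) (n : Ideal R) [n.IsMaximal]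
    (hint : ∀ a, IsIntegral T (Ideal.Quotient.mk (n.comap (algebraMap A R)) a))
    (s : Localization.AtPrime n) :
    IsIntegral l (IsLocalRing.residue (Localization.AtPrime n) s) := by
  let κ := IsLocalRing.ResidueField (Localization.AtPrime n)
  let ρ : R →+* κ := (IsLocalRing.residue _).comp (algebraMap R (Localization.AtPrime n))
  have hl : ∀ x : l, IsIntegral l (ρ x) := fun x => isIntegral_algebraMap (R := l) (A := κ) (x := x)
  -- elements of `A`
  have hA : ∀ a : A, IsIntegral l (ρ (algebraMap A R a)) := by
    intro a
    obtain ⟨P, hP, hPa⟩ := hint a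
    let j : T →+* l := ((algebraMap A R).comp (algebraMap T A)).codRestrict l hTl
    let ψ : (A ⧸ n.comap (algebraMap A R)) →+* κ :=
      Ideal.Quotient.lift _ (ρ.comp (algebraMap A R)) fun x hx => by
        rw [RingHom.comp_apply, RingHom.comp_apply, IsLocalRing.residue_eq_zero_iff]
        rw [← Ideal.mem_comap, ← Ideal.under_def, IsLocalization.AtPrime.under_maximalIdeal _ n]
        exact hx
    refine ⟨P.map j, hP.map j, ?_⟩
    have := congrArg ψ hPa
    rw [Polynomial.hom_eval₂, map_zero] at this
    rw [Polynomial.eval₂_map]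
    exact this
  obtain ⟨g, hg, hfg⟩ := hfl
  have hR : ∀ r : R, IsIntegral l (ρ r) := by
    intro r
    obtain ⟨⟨a, w⟩, ha⟩ := IsLocalization.surj (Submonoid.powers f) r
    obtain ⟨_, m, rfl⟩ := w
    dsimp only at ha
    have : r = algebraMap A R a * g ^ m := by
      rw [← ha, map_pow, mul_assoc, ← mul_pow, hfg, one_pow, mul_one]
    rw [this, map_mul, map_pow]
    exact (hA a).mul ((hl ⟨g, hg⟩).pow m)
  obtain ⟨⟨r, u⟩, hr⟩ := IsLocalization.surj n.primeCompl s
  dsimp only at hr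
  obtain ⟨v, hv⟩ : ∃ v, (u : R) * v - 1 ∈ n := by
    obtain ⟨v, i, hi, h⟩ := Ideal.IsMaximal.exists_inv (I := n) ‹_› u.2
    refine ⟨v, ?_⟩
    have : (u : R) * v - 1 = -i := by rw [← h]; ring
    rw [this]; exact n.neg_mem hi
  have hv' : ρ u * ρ v = 1 := by
    rw [← map_mul, ← sub_eq_zero, ← map_one ρ, ← map_sub]
    change IsLocalRing.residue _ _ = 0
    rw [IsLocalRing.residue_eq_zero_iff, ← Ideal.mem_comap, ← Ideal.under_def,
      IsLocalization.AtPrime.under_maximalIdeal _ n]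
    exact hv
  have hr' := congrArg (IsLocalRing.residue (Localization.AtPrime n)) hr
  rw [map_mul] at hr'
  change _ * ρ u = ρ r at hr'
  have : IsLocalRing.residue (Localization.AtPrime n) s = ρ (r * v) := by
    rw [map_mul, ← hr', mul_assoc, hv', mul_one]
  rw [this]
  exact hR _

/-- Let `A_p` be regular, where `p` is the trace on `A` of a maximal ideal `n` of `A_f`. Since `p ≠ 𝔪`
has height at most `d`, the maximal ideal of `(A_f)_n = A_p` is generated by `d` elements. -/
theorem exists_fin_span_eq_maximalIdeal {A R : Type*} [CommRing A] [IsLocalRing A]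
    [IsNoetherianRing A] [CommRing R] [Algebra A R] {f : A} [IsLocalization.Away f R] {d : ℕ}
    (hdim : ringKrullDim A = ((d + 1 : ℕ) : WithBot ℕ∞)) (hf : f ∈ IsLocalRing.maximalIdeal A)
    (n : Ideal R) [n.IsMaximal]
    (hreg : IsRegularLocalRing (Localization.AtPrime (n.comap (algebraMap A R)))) :
    ∃ x : Fin d → Localization.AtPrime n,
      IsLocalRing.maximalIdeal (Localization.AtPrime n) = Ideal.span (Set.range x) := by
  let p := n.comap (algebraMap A R)
  have hfp : f ∉ p := fun h =>
    Ideal.IsPrime.ne_top (I := n) inferInstance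
      (Ideal.eq_top_of_isUnit_mem n h (IsLocalization.Away.algebraMap_isUnit f))
  have hloc : IsLocalization.AtPrime (Localization.AtPrime n) p :=
    IsLocalization.isLocalization_isLocalization_atPrime_isLocalization (Submonoid.powers f)
      (Localization.AtPrime n) n
  have hreg' : IsRegularLocalRing (Localization.AtPrime n) :=
    IsRegularLocalRing.of_ringEquiv (IsLocalization.algEquiv p.primeCompl
      (Localization.AtPrime p) (Localization.AtPrime n)).toRingEquiv
  have hlt : p < IsLocalRing.maximalIdeal A :=
    lt_of_le_of_ne (IsLocalRing.le_maximalIdeal (Ideal.IsPrime.ne_top inferInstance))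
      fun h => hfp (h ▸ hf)
  have hht : p.height < (d + 1 : ℕ) := by
    refine Ideal.height_le_iff.1 ?_ p inferInstance hlt
    have := IsLocalRing.maximalIdeal_height_eq_ringKrullDim (R := A)
    rw [hdim] at this
    exact (WithBot.coe_injective this).le
  have hrank := hreg'.spanFinrank_maximalIdeal
  rw [IsLocalization.AtPrime.ringKrullDim_eq_height p (Localization.AtPrime n)] at hrank
  obtain ⟨s, hs, hspan⟩ := (IsNoetherian.noetherian
    (IsLocalRing.maximalIdeal (Localization.AtPrime n))).exists_span_finset_card_eq_spanFinrank
  have hcard : s.card ≤ d := by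
    rw [← hs] at hrank
    have h1 : ((s.card : ℕ) : ℕ∞) = p.height := WithBot.coe_injective (by exact_mod_cast hrank)
    rw [← h1] at hht
    have : s.card < d + 1 := by exact_mod_cast hht
    omega
  obtain ⟨x, hx⟩ := Ideal.exists_fin_span_eq s hcard
  exact ⟨x, hspan.symm.trans hx.symm⟩

/-! ### Derivations of `A`, of `A_f`, and of its local rings -/

theorem Derivation.linearIndependent_of_apply_eq {l S ι : Type*} [CommRing l] [CommRing S]
    [IsDomain S] [Algebra l S] [Fintype ι] [DecidableEq ι] {c : S} (hc : c ≠ 0)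
    (D : ι → Derivation l S S) (y : ι → S) (h : ∀ i j, D i (y j) = if i = j then c else 0) :
    LinearIndependent S D := by
  rw [Fintype.linearIndependent_iff]
  intro g hg j
  have h1 := congrArg (fun G : Derivation l S S => G (y j)) hg
  rw [Derivation.sum_smul_apply, Finset.sum_eq_single j] at h1
  · rw [h, if_pos rfl, smul_eq_mul, Derivation.zero_apply] at h1
    exact (mul_eq_zero.1 h1).resolve_right hc
  · intro i _ hij
    rw [h, if_neg hij, smul_zero]
  · simp

section

variable {A k : Type*} [CommRing A] [IsDomain A] [IsNoetherianRing A] [IsLocalRing A]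
  [IsAdicComplete (IsLocalRing.maximalIdeal A) A] [Field k] [CharZero k] [Algebra k A]

/-- A derivation over `k⟦f⟧` is determined by its values on `y`, where `f, y` is a system of
parameters; hence `Der_T(A)` embeds into `A ^ d`. -/
theorem Derivation.finite_of_parameters
    (hk : Function.Surjective ((IsLocalRing.residue A).comp (algebraMap k A)))
    {d : ℕ} (hdim : ringKrullDim A = ((d + 1 : ℕ) : WithBot ℕ∞)) {f : A}
    (hf : f ∈ IsLocalRing.maximalIdeal A) {y : Fin d → A}
    (hy : ∀ i, y i ∈ IsLocalRing.maximalIdeal A)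
    (hrad : IsLocalRing.maximalIdeal A ≤
      (Ideal.span (Set.range (Fin.cons f y : Fin (d + 1) → A))).radical) :
    Module.Finite A (Derivation (powerSeriesSubring k (IsLocalRing.maximalIdeal A) f hf) A A) := by
  have : IsHausdorff (Ideal.span (Set.range y)) A := by
    refine IsHausdorff.of_isDomain _ fun h => (IsLocalRing.maximalIdeal.isMaximal A).ne_top
      (top_le_iff.1 (h ▸ ?_))
    rw [Ideal.span_le]
    rintro _ ⟨i, rfl⟩
    exact hy i
  let ev : Derivation (powerSeriesSubring k (IsLocalRing.maximalIdeal A) f hf) A A →ₗ[A]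
      (Fin d → A) :=
    { toFun := fun D i => D (y i)
      map_add' := fun _ _ => rfl
      map_smul' := fun _ _ => rfl }
  refine Module.Finite.of_injective ev ((injective_iff_map_eq_zero _).2 fun D hD => ?_)
  have h := Derivation.eq_zero_of_parameters hk hdim hf hy hrad (D.restrictScalars ℤ)
    (fun t ht => D.map_algebraMap (⟨t, ht⟩ : powerSeriesSubring k _ f hf)) fun i => congrFun hD i
  ext a
  exact congrArg (fun G => G a) h

/-- `Der_T(A)_f = Der_ℓ(A_f)`. The prime `n`, whose trace contains the parameters `y`, serves only to
make `A_f` separated for the `(y)`-adic topology. -/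
theorem Derivation.exists_isLocalizedModule_away
    (hk : Function.Surjective ((IsLocalRing.residue A).comp (algebraMap k A)))
    {d : ℕ} (hdim : ringKrullDim A = ((d + 1 : ℕ) : WithBot ℕ∞)) {f : A} (hf0 : f ≠ 0)
    (hf : f ∈ IsLocalRing.maximalIdeal A) {y : Fin d → A}
    (hrad : IsLocalRing.maximalIdeal A ≤
      (Ideal.span (Set.range (Fin.cons f y : Fin (d + 1) → A))).radical)
    (R : Type*) [CommRing R] [Algebra A R] [IsLocalization.Away f R]
    (n : Ideal R) [n.IsPrime] (hy : ∀ i, y i ∈ n.comap (algebraMap A R)) :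
    ∃ Φ : Derivation (powerSeriesSubring k (IsLocalRing.maximalIdeal A) f hf) A A →ₗ[A]
        Derivation (laurentSeriesSubring k (IsLocalRing.maximalIdeal A) f hf R) R R,
      (∀ D a, Φ D (algebraMap A R a) = algebraMap A R (D a)) ∧
        IsLocalizedModule (Submonoid.powers f) Φ := by
  have hle : Submonoid.powers f ≤ nonZeroDivisors A :=
    powers_le_nonZeroDivisors_of_noZeroDivisors hf0
  have hinj : Function.Injective (algebraMap A R) := IsLocalization.injective R hle
  have : IsDomain R := IsLocalization.isDomain_of_le_nonZeroDivisors R hle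
  have : IsNoetherianRing R := IsLocalization.isNoetherianRing (Submonoid.powers f) R ‹_›
  have hym : ∀ i, y i ∈ IsLocalRing.maximalIdeal A := fun i =>
    IsLocalRing.le_maximalIdeal (Ideal.IsPrime.ne_top inferInstance) (hy i)
  obtain ⟨c, hc, E, hE⟩ := exists_dual_derivations hk hdim hf hym hrad
  refine Derivation.exists_isLocalizedModule _ hinj (fun D hD x => ?_) (fun t => ?_)
    fun D hD => ?_
  · exact D.eq_zero_of_mem_laurentSeriesSubring (k := k) (hf := hf)
      (fun t ht => hD ⟨t, ht⟩) x x.2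
  · exact ⟨⟨_, algebraMap_mem_laurentSeriesSubring t.2⟩, rfl⟩
  · exact IsLocalization.exists_mul_mem_of_forall _
      ((map_ne_zero_iff _ hinj).2 hc) (fun i => D (y i)) (fun i a => E i a) D
      fun a => Derivation.mul_apply_eq_sum_of_parameters hk hdim hf hym hrad hE hinj n
        (Ideal.IsPrime.ne_top ‹_›) hy D (fun t ht => hD ⟨t, ht⟩) a

/-- When `A_p` is regular at the trace `p` of `n`, `Der_ℓ(A_f)_n = Der_ℓ((A_f)_n)` is free of rank
`d`. -/
theorem Derivation.exists_isLocalizedModule_atPrime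
    (hk : Function.Surjective ((IsLocalRing.residue A).comp (algebraMap k A)))
    {d : ℕ} (hdim : ringKrullDim A = ((d + 1 : ℕ) : WithBot ℕ∞)) {f : A} (hf0 : f ≠ 0)
    (hf : f ∈ IsLocalRing.maximalIdeal A)
    {R : Type*} [CommRing R] [Algebra A R] [IsLocalization.Away f R] (n : Ideal R) [n.IsMaximal]
    (hreg : IsRegularLocalRing (Localization.AtPrime (n.comap (algebraMap A R)))) :
    (∃ Ψ : Derivation (laurentSeriesSubring k (IsLocalRing.maximalIdeal A) f hf R) R R →ₗ[R]
        Derivation (laurentSeriesSubring k (IsLocalRing.maximalIdeal A) f hf R)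
          (Localization.AtPrime n) (Localization.AtPrime n),
      (∀ D r, Ψ D (algebraMap R (Localization.AtPrime n) r) =
        algebraMap R (Localization.AtPrime n) (D r)) ∧ IsLocalizedModule n.primeCompl Ψ) ∧
    Nonempty (Module.Basis (Fin d) (Localization.AtPrime n)
      (Derivation (laurentSeriesSubring k (IsLocalRing.maximalIdeal A) f hf R)
        (Localization.AtPrime n) (Localization.AtPrime n))) := by
  have hle : Submonoid.powers f ≤ nonZeroDivisors A :=
    powers_le_nonZeroDivisors_of_noZeroDivisors hf0
  have hinj : Function.Injective (algebraMap A R) := IsLocalization.injective R hle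
  have : IsDomain R := IsLocalization.isDomain_of_le_nonZeroDivisors R hle
  have : IsNoetherianRing R := IsLocalization.isNoetherianRing (Submonoid.powers f) R ‹_›
  set S := Localization.AtPrime n
  have : IsDomain S :=
    IsLocalization.isDomain_of_le_nonZeroDivisors S n.primeCompl_le_nonZeroDivisors
  have : IsNoetherianRing S := IsLocalization.isNoetherianRing n.primeCompl S ‹_›
  have hinjS : Function.Injective (algebraMap R S) :=
    IsLocalization.injective S n.primeCompl_le_nonZeroDivisors
  have hinjA : Function.Injective (algebraMap A S) := by
    rw [IsScalarTower.algebraMap_eq A R S]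
    exact hinjS.comp hinj
  have hfp : f ∉ n.comap (algebraMap A R) := fun h =>
    Ideal.IsPrime.ne_top (I := n) inferInstance
      (Ideal.eq_top_of_isUnit_mem n h (IsLocalization.Away.algebraMap_isUnit f))
  obtain ⟨y, hy, hrad⟩ := IsLocalRing.exists_parameters_mem hdim hf _ hfp
    fun q hq h => Ideal.mem_of_comap_lt n q hq h
  have hym : ∀ i, y i ∈ IsLocalRing.maximalIdeal A := fun i =>
    IsLocalRing.le_maximalIdeal (Ideal.IsPrime.ne_top inferInstance) (hy i)
  obtain ⟨c, hc, E, hE⟩ := exists_dual_derivations hk hdim hf hym hrad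
  obtain ⟨Φ, hΦ, -⟩ := Derivation.exists_isLocalizedModule_away hk hdim hf0 hf hrad R n hy
  have hyS : ∀ i, algebraMap A S (y i) ∈ IsLocalRing.maximalIdeal S := by
    intro i
    rw [IsScalarTower.algebraMap_apply A R S, ← Ideal.mem_comap, ← Ideal.under_def,
      IsLocalization.AtPrime.under_maximalIdeal S n]
    exact hy i
  -- every `ℓ`-derivation `R → S` is a combination of the extended dual derivations
  have hexp : ∀ D : Derivation ℤ R S,
      (∀ t : laurentSeriesSubring k (IsLocalRing.maximalIdeal A) f hf R, D t = 0) →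
      ∀ r, algebraMap R S (algebraMap A R c) * D r =
        ∑ i, D (algebraMap A R (y i)) * algebraMap R S (Φ (E i) r) := by
    intro D hD
    have hA := Derivation.mul_apply_eq_sum_of_parameters hk hdim hf hym hrad hE hinjA
      (IsLocalRing.maximalIdeal S) (IsLocalRing.maximalIdeal.isMaximal S).ne_top hyS
      (D.compAlgebraMap A) fun t ht => hD ⟨_, algebraMap_mem_laurentSeriesSubring ht⟩
    let D₁ : Derivation ℤ R S := algebraMap A R c • D
    let D₂ : Derivation ℤ R S := ∑ i, D (algebraMap A R (y i)) •
      (Algebra.linearMap R S).compDer ((Φ (E i)).restrictScalars ℤ)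
    have h1 : ∀ r, D₁ r = algebraMap R S (algebraMap A R c) * D r := fun r =>
      Algebra.smul_def (algebraMap A R c) (D r)
    have h2 : ∀ r, D₂ r = ∑ i, D (algebraMap A R (y i)) * algebraMap R S (Φ (E i) r) :=
      fun r => Derivation.sum_smul_apply _ _ _ r
    have h12 : D₁ = D₂ := Derivation.ext_of_isLocalization (Submonoid.powers f) fun a => by
      rw [h1, h2, ← IsScalarTower.algebraMap_apply A R S]
      refine (hA a).trans (Finset.sum_congr rfl fun i _ => ?_)
      rw [hΦ, ← IsScalarTower.algebraMap_apply A R S]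
      rfl
    intro r
    rw [← h1, ← h2, h12]
  have hcS : algebraMap R S (algebraMap A R c) ≠ 0 :=
    (map_ne_zero_iff _ hinjS).2 ((map_ne_zero_iff _ hinj).2 hc)
  obtain ⟨Ψ, hΨ, hΨloc⟩ := Derivation.exists_isLocalizedModule
    (T₀ := laurentSeriesSubring k (IsLocalRing.maximalIdeal A) f hf R)
    (T₁ := laurentSeriesSubring k (IsLocalRing.maximalIdeal A) f hf R) (S := S) n.primeCompl hinjS
    (fun D hD t => hD t) (fun t => ⟨t, rfl⟩) fun D hD =>
      IsLocalization.exists_mul_mem_of_forall _ hcS _ (fun i r => Φ (E i) r) D (hexp D hD)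
  refine ⟨⟨Ψ, hΨ, hΨloc⟩, ?_⟩
  obtain ⟨x, hx⟩ := exists_fin_span_eq_maximalIdeal hdim hf n hreg
  have : CharZero (laurentSeriesSubring k (IsLocalRing.maximalIdeal A) f hf R) :=
    charZero_laurentSeriesSubring
  refine Derivation.exists_basis_of_linearIndependent isUnit_natCast_laurentSeriesSubring
    (fun s => ?_) x hx (fun i => Ψ (Φ (E i)))
    (Derivation.linearIndependent_of_apply_eq hcS _
      (fun j => algebraMap R S (algebraMap A R (y j))) fun i j => ?_)
  · exact isIntegral_residue_of_isIntegral_mk (f := f)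
      (T := powerSeriesSubring k (IsLocalRing.maximalIdeal A) f hf) _
      (fun t => algebraMap_mem_laurentSeriesSubring t.2) exists_inv_mem_laurentSeriesSubring n
      (isIntegral_mk_of_parameters_mem hk hf hrad _ hy) s
  · rw [hΨ, hΦ, hE]
    split_ifs
    · rfl
    · rw [map_zero, map_zero]

end

/-- A finite module over a Noetherian ring whose localizations at the maximal ideals are free of
rank `d` is projective of constant rank `d`. -/
theorem Module.projective_and_rankAtStalk_eq {R M : Type*} [CommRing R] [IsNoetherianRing R]
    [AddCommGroup M] [Module R M] [Module.Finite R M] (d : ℕ)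
    (N : ∀ (n : Ideal R) [n.IsMaximal], Type*)
    [∀ (n : Ideal R) [n.IsMaximal], AddCommGroup (N n)]
    [∀ (n : Ideal R) [n.IsMaximal], Module R (N n)]
    [∀ (n : Ideal R) [n.IsMaximal], Module (Localization.AtPrime n) (N n)]
    [∀ (n : Ideal R) [n.IsMaximal], IsScalarTower R (Localization.AtPrime n) (N n)]
    (h : ∀ (n : Ideal R) [n.IsMaximal], ∃ Ψ : M →ₗ[R] N n, IsLocalizedModule n.primeCompl Ψ)
    (hb : ∀ (n : Ideal R) [n.IsMaximal],
      Nonempty (Module.Basis (Fin d) (Localization.AtPrime n) (N n))) :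
    Module.Projective R M ∧ ∀ p : PrimeSpectrum R, Module.rankAtStalk M p = d := by
  have hb' : ∀ (n : Ideal R) [n.IsMaximal], Nonempty (Module.Basis (Fin d)
      (Localization.AtPrime n) (LocalizedModule n.primeCompl M)) := by
    intro n _
    obtain ⟨Ψ, _⟩ := h n
    obtain ⟨b⟩ := hb n
    exact ⟨b.map ((IsLocalizedModule.linearEquiv n.primeCompl
      (LocalizedModule.mkLinearMap n.primeCompl M) Ψ).extendScalarsOfIsLocalization
        n.primeCompl (Localization.AtPrime n)).symm⟩
  have : Module.FinitePresentation R M := Module.finitePresentation_of_finite R M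
  have hproj : Module.Projective R M := Module.projective_of_localization_maximal fun n hn => by
    obtain ⟨b⟩ := hb' n
    have := Module.Free.of_basis b
    infer_instance
  refine ⟨hproj, fun p => ?_⟩
  obtain ⟨n, hn, hpn⟩ := Ideal.exists_le_maximal p.asIdeal p.2.ne_top
  obtain ⟨b⟩ := hb' n
  rw [Module.rankAtStalk_eq_of_le_of_finite_of_flat M (q := ⟨n, hn.isPrime⟩) hpn,
    Module.rankAtStalk, Module.finrank_eq_card_basis b, Fintype.card_fin]

/-! ### The structure of `Der_T(A)` and `Der_ℓ(A_f)` -/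

theorem theorem3p2
    {A : Type*} [CommRing A] [IsDomain A] [IsNoetherianRing A] [IsLocalRing A]
    [IsAdicComplete (IsLocalRing.maximalIdeal A) A]
    [CharZero (IsLocalRing.ResidueField A)]
    {k : Type*} [Field k] [Algebra k A]
    (hk : Function.Bijective ((IsLocalRing.residue A).comp (algebraMap k A)))
    (d : ℕ) (hd : 1 ≤ d) (hdim : ringKrullDim A = ((d + 1 : ℕ) : WithBot ℕ∞))
    (hA : ¬ IsRegularLocalRing A)
    (J : Ideal A) (hJ : PrimeSpectrum.zeroLocus (J : Set A) = singularLocus A)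
    (f : A) (hfJ : f ∈ J) (hf0 : f ≠ 0)
    (R : Type*) [CommRing R] [Algebra A R] [IsLocalization.Away f R]
    (T : Subring A)
    (hT : T = powerSeriesSubring k (IsLocalRing.maximalIdeal A) f
      (mem_maximalIdeal_of_zeroLocus_eq hA hJ hfJ))
    (l : Subring R)
    (hl : l = laurentSeriesSubring k (IsLocalRing.maximalIdeal A) f
      (mem_maximalIdeal_of_zeroLocus_eq hA hJ hfJ) R) :
    (Module.Finite A (Derivation T A A) ∧
      (d : Cardinal) ≤
        Module.rank (FractionRing A) (FractionRing A ⊗[A] Derivation T A A)) ∧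
    ((∃ Φ : Derivation T A A →ₗ[A] Derivation l R R,
        (∀ (D : Derivation T A A) (a : A), Φ D (algebraMap A R a) = algebraMap A R (D a)) ∧
        IsLocalizedModule (Submonoid.powers f) Φ) ∧
      Module.Finite R (Derivation l R R)) ∧
    (∀ (n : Ideal R) [n.IsMaximal],
      (∃ Ψ : Derivation l R R →ₗ[R]
          Derivation l (Localization.AtPrime n) (Localization.AtPrime n),
        (∀ (D : Derivation l R R) (r : R),
          Ψ D (algebraMap R (Localization.AtPrime n) r) =
            algebraMap R (Localization.AtPrime n) (D r)) ∧
        IsLocalizedModule n.primeCompl Ψ) ∧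
      Module.Free (Localization.AtPrime n)
        (Derivation l (Localization.AtPrime n) (Localization.AtPrime n)) ∧
      Module.rank (Localization.AtPrime n)
        (Derivation l (Localization.AtPrime n) (Localization.AtPrime n)) = (d : Cardinal)) ∧
    (Module.Projective R (Derivation l R R) ∧
      ∀ p : PrimeSpectrum R, Module.rankAtStalk (Derivation l R R) p = d) := by
  subst hT hl
  have hf := mem_maximalIdeal_of_zeroLocus_eq hA hJ hfJ
  have : CharZero k := by
    refine ⟨fun m n h => ?_⟩
    have h' := congrArg ((IsLocalRing.residue A).comp (algebraMap k A)) h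
    rw [map_natCast, map_natCast] at h'
    exact Nat.cast_injective h'
  have hle : Submonoid.powers f ≤ nonZeroDivisors A :=
    powers_le_nonZeroDivisors_of_noZeroDivisors hf0
  have : IsDomain R := IsLocalization.isDomain_of_le_nonZeroDivisors R hle
  have : IsNoetherianRing R := IsLocalization.isNoetherianRing (Submonoid.powers f) R ‹_›
  -- parameters adapted to one maximal ideal `m` of `A_f` serve for the statements on `A` and `A_f`
  obtain ⟨m, hm⟩ := Ideal.exists_maximal R
  have hfp : f ∉ m.comap (algebraMap A R) := fun h =>
    Ideal.IsPrime.ne_top (I := m) inferInstance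
      (Ideal.eq_top_of_isUnit_mem m h (IsLocalization.Away.algebraMap_isUnit f))
  obtain ⟨y, hy, hrad⟩ := IsLocalRing.exists_parameters_mem hdim hf _ hfp
    fun q hq h => Ideal.mem_of_comap_lt m q hq h
  have hym : ∀ i, y i ∈ IsLocalRing.maximalIdeal A := fun i =>
    IsLocalRing.le_maximalIdeal (Ideal.IsPrime.ne_top inferInstance) (hy i)
  have hfin := Derivation.finite_of_parameters (k := k) hk.2 hdim hf hym hrad
  obtain ⟨c, hc, E, hE⟩ := exists_dual_derivations (k := k) hk.2 hdim hf hym hrad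
  have hlin := Derivation.linearIndependent_of_apply_eq hc E y hE
  obtain ⟨Φ, hΦ, hΦloc⟩ :=
    Derivation.exists_isLocalizedModule_away (k := k) hk.2 hdim hf0 hf hrad R m hy
  have hfinR : Module.Finite R
      (Derivation (laurentSeriesSubring k (IsLocalRing.maximalIdeal A) f hf R) R R) :=
    Module.Finite.of_isLocalizedModule (Submonoid.powers f) Φ
  have hloc := fun (n : Ideal R) [n.IsMaximal] =>
    Derivation.exists_isLocalizedModule_atPrime (k := k) hk.2 hdim hf0 hf n <| by
      -- `f ∈ J` is not in the trace of `n`, which therefore is not in the singular locus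
      by_contra hsing
      have hmem : (⟨n.comap (algebraMap A R), inferInstance⟩ : PrimeSpectrum A) ∈
          singularLocus A := hsing
      rw [← hJ] at hmem
      exact Ideal.IsPrime.ne_top (I := n) inferInstance
        (Ideal.eq_top_of_isUnit_mem n (hmem hfJ) (IsLocalization.Away.algebraMap_isUnit f))
  refine ⟨⟨hfin, ?_⟩, ⟨⟨Φ, hΦ, hΦloc⟩, hfinR⟩, fun n _ => ⟨(hloc n).1, ?_, ?_⟩, ?_⟩
  · have h1 := (hlin.of_isLocalizedModule (FractionRing A) (nonZeroDivisors A)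
      (TensorProduct.mk A (FractionRing A) _ 1)).cardinal_lift_le_rank
    simpa using h1
  · obtain ⟨b⟩ := (hloc n).2
    exact Module.Free.of_basis b
  · obtain ⟨b⟩ := (hloc n).2
    rw [rank_eq_card_basis b, Fintype.card_fin]
  · exact Module.projective_and_rankAtStalk_eq d _ (fun n _ => (hloc n).1.imp fun _ h => h.2)
      fun n _ => (hloc n).2
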